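/- Let $\Lambda$ be an artin algebra, that is, an algebra over a commutative artinian ring $R$ which is finitely generated as an $R$-module. All modules are finitely generated left $\Lambda$-modules unless stated otherwise. Let $D=\operatorname{Hom}_R(-,J)$ be the usual duality, where $J$ is the injective envelope of the $R$-module $R/\operatorname{rad}R$. For a right module $M$ with minimal projective presentation $P_1\to P_0\to M\to 0$, let $\operatorname{Tr}M$ be the cokernel of $\operatorname{Hom}_\Lambda(P_0,\Lambda)\to\operatorname{Hom}_\Lambda(P_1,\Lambda)$, a left module. Let $\alpha\colon X\to Y$ be a morphism. (a) A module $C$ right determines $\alpha$ if every morphism $\alpha'\colon X'\to Y$ such that $\alpha'\phi$ factors through $\alpha$ for all $\phi\colon C\to X'$ itself factors through $\alpha$. A minimal right determiner for $\alpha$ is a module $T$ which right determines $\alpha$ and is isomorphic to a direct summand of every module $C$ which right determines $\alpha$. (b) Write $X=X_0\oplus X_1$ with $X_0\subseteq\operatorname{Ker}\alpha$ and such that no nonzero direct summand of $X_1$ lies in the kernel of $\alpha|_{X_1}$. The intrinsic kernel of $\alpha$ is the kernel of $\alpha|_{X_1}$; it is unique up to isomorphism. (c) An indecomposable module $N$ almost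 factors through $\alpha$ if there is a morphism $\eta\colon N\to Y$ which does not factor through $\alpha$, whereas $\eta\psi$ factors through $\alpha$ for every radical map $\psi\colon M\to N$ (a map $\psi$ such that $1_M-g\psi$ is invertible for all $g\colon N\to M$). Theorem 2. Let $T$ be the direct sum, one from each isomorphism class, of the modules of the form $\operatorname{Tr}D(L)$, where $L$ is an indecomposable direct summand of the intrinsic kernel of $\alpha$, and of the indecomposable projective modules which almost factor through $\alpha$. Then there are only finitely many summands, and $T$ is a minimal right determiner for $\alpha$. -/

import Mathlib

open scoped DirectSum

universe u

namespace RightDet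

noncomputable section

/-! ### Injective envelopes -/

/-- `i : M → E` is an injective envelope: `E` is injective and `i` is an essential monomorphism. -/
structure IsInjectiveEnvelope {R : Type u} [Ring R] {M E : Type u} [AddCommGroup M] [Module R M]
    [AddCommGroup E] [Module R E] (i : M →ₗ[R] E) : Prop where
  injective_module : Module.Injective R E
  injective : Function.Injective i
  essential : ∀ U : Submodule R E, U ⊓ LinearMap.range i = ⊥ → U = ⊥

theorem exists_maximal_essential {R : Type u} [Ring R] {I : Type u} [AddCommGroup I] [Module R I]
    (S : Submodule R I) :
    ∃ N : Submodule R I, Maximal (fun N => S ≤ N ∧ ∀ U ≤ N, U ⊓ S = ⊥ → U = ⊥) N := by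
  obtain ⟨N, -, hN⟩ := zorn_le_nonempty₀
    {N : Submodule R I | S ≤ N ∧ ∀ U ≤ N, U ⊓ S = ⊥ → U = ⊥} (by
      intro c hc hchain y hy
      refine ⟨sSup c, ⟨(hc hy).1.trans (le_sSup hy), ?_⟩, fun z hz => le_sSup hz⟩
      intro U hU hUS
      rw [eq_bot_iff]
      intro x hx
      obtain ⟨N, hNc, hxN⟩ :=
        (Submodule.mem_sSup_of_directed ⟨y, hy⟩ hchain.directedOn).1 (hU hx)
      have h := (hc hNc).2 (Submodule.span R {x})
        ((Submodule.span_singleton_le_iff_mem _ _).2 hxN) (by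
          rw [eq_bot_iff, ← hUS]
          exact inf_le_inf_right _ ((Submodule.span_singleton_le_iff_mem _ _).2 hx))
      simpa using (Submodule.span_singleton_eq_bot.1 h)) S ⟨le_rfl, fun U hU h => by
        rwa [inf_eq_left.2 hU] at h⟩
  exact ⟨N, hN⟩

theorem exists_maximal_disjoint {R : Type u} [Ring R] {I : Type u} [AddCommGroup I] [Module R I]
    (N : Submodule R I) : ∃ C : Submodule R I, Maximal (fun C => Disjoint N C) C := by
  obtain ⟨C, -, hC⟩ := zorn_le_nonempty₀ {C : Submodule R I | Disjoint N C} (by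
      intro c hc hchain y hy
      refine ⟨sSup c, ?_, fun z hz => le_sSup hz⟩
      exact (hchain.directedOn).disjoint_sSup_right.2 fun b hb => hc hb) ⊥ disjoint_bot_right
  exact ⟨C, hC⟩

theorem isCompl_of_maximal {R : Type u} [Ring R] {I : Type u} [AddCommGroup I] [Module R I]
    [Module.Injective R I] {S N C : Submodule R I}
    (hN : Maximal (fun N => S ≤ N ∧ ∀ U ≤ N, U ⊓ S = ⊥ → U = ⊥) N)
    (hC : Maximal (fun C => Disjoint N C) C) : IsCompl N C := by
  have hdis : N ⊓ C = ⊥ := disjoint_iff.1 hC.prop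
  have hinj : Function.Injective (C.mkQ ∘ₗ N.subtype) := by
    rw [← LinearMap.ker_eq_bot, eq_bot_iff]
    intro x hx
    have hx' : (x : I) ∈ C := by simpa using hx
    have : (x : I) ∈ N ⊓ C := ⟨x.2, hx'⟩
    rw [hdis] at this
    simpa using this
  obtain ⟨g, hg⟩ := Module.Injective.out (C.mkQ ∘ₗ N.subtype) hinj N.subtype
  have hg' : ∀ x ∈ N, g (C.mkQ x) = x := fun x hx => hg ⟨x, hx⟩
  have hess : ∀ U : Submodule R (I ⧸ C), U ⊓ N.map C.mkQ = ⊥ → U = ⊥ := by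
    intro U hU
    have hle : C ≤ U.comap C.mkQ := by
      intro x hx
      have : C.mkQ x = 0 := by simpa using hx
      simp [Submodule.mem_comap, this]
    have hd : Disjoint N (U.comap C.mkQ) := by
      rw [disjoint_iff, eq_bot_iff]
      rintro x ⟨hxN, hxU⟩
      have : C.mkQ x ∈ U ⊓ N.map C.mkQ := ⟨hxU, Submodule.mem_map_of_mem hxN⟩
      rw [hU] at this
      have hxC : x ∈ C := by simpa using this
      rw [← hdis]
      exact ⟨hxN, hxC⟩
    have hle' := hC.le_of_ge hd hle
    rw [eq_bot_iff]
    intro y hy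
    obtain ⟨x, rfl⟩ := C.mkQ_surjective y
    have : x ∈ C := hle' hy
    simpa using this
  have hgker : LinearMap.ker g = ⊥ := by
    apply hess
    rw [eq_bot_iff]
    rintro _ ⟨hy, x, hx, rfl⟩
    have h0 : g (C.mkQ x) = 0 := hy
    rw [hg' x hx] at h0
    simp [h0]
  have hrange : LinearMap.range g ≤ N := by
    refine hN.le_of_ge ⟨?_, ?_⟩ ?_
    · intro x hx
      exact ⟨C.mkQ x, hg' x (hN.prop.1 hx)⟩
    · intro U hU hUS
      have hUN : U ⊓ N = ⊥ := hN.prop.2 _ inf_le_right (by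
        rw [eq_bot_iff, ← hUS]
        exact inf_le_inf_right _ inf_le_left)
      have hb : U.comap g = ⊥ := by
        apply hess
        rw [eq_bot_iff]
        rintro _ ⟨hy, x, hx, rfl⟩
        have h1 : g (C.mkQ x) ∈ U := hy
        rw [hg' x hx] at h1
        have : x ∈ U ⊓ N := ⟨h1, hx⟩
        rw [hUN] at this
        have hx0 : x = 0 := by simpa using this
        simp [hx0]
      rw [eq_bot_iff]
      intro y hy
      obtain ⟨z, rfl⟩ := hU hy
      have : z ∈ U.comap g := hy
      rw [hb] at this
      have hz : z = 0 := by simpa using this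
      simp [hz]
    · intro x hx
      exact ⟨C.mkQ x, hg' x hx⟩
  refine ⟨hC.prop, codisjoint_iff.2 (eq_top_iff.2 fun x _ => ?_)⟩
  have hn : g (C.mkQ x) ∈ N := hrange ⟨_, rfl⟩
  have hc : x - g (C.mkQ x) ∈ C := by
    have h1 : C.mkQ (x - g (C.mkQ x)) = 0 := by
      apply LinearMap.ker_eq_bot.1 hgker
      rw [map_sub, map_sub, hg' _ hn, sub_self, map_zero]
    exact (Submodule.Quotient.mk_eq_zero C).1 h1
  have := Submodule.add_mem_sup hn hc
  simpa using this

theorem injective_of_isCompl {R : Type u} [Ring R] {I : Type u} [AddCommGroup I] [Module R I]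
    [Module.Injective R I] {N C : Submodule R I} (h : IsCompl N C) : Module.Injective R N where
  out X Y _ _ _ _ f hf g := by
    obtain ⟨k, hk⟩ := Module.Injective.out f hf (N.subtype ∘ₗ g)
    refine ⟨Submodule.projectionOnto N C h ∘ₗ k, fun x => ?_⟩
    simp only [LinearMap.comp_apply, hk]
    exact Submodule.projectionOnto_apply_left h (g x)

/-- Every module over a ring has an injective envelope. -/
theorem exists_injectiveEnvelope (R : Type u) [Ring R] (M : Type u) [AddCommGroup M]
    [Module R M] : ∃ (E : ModuleCat.{u} R) (i : M →ₗ[R] E), IsInjectiveEnvelope i := by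
  obtain ⟨P⟩ := CategoryTheory.EnoughInjectives.presentation (ModuleCat.of R M)
  have hI : Module.Injective R P.J :=
    (Module.injective_iff_injective_object R P.J).2 P.injective
  have hf : Function.Injective P.f.hom := (ModuleCat.mono_iff_injective P.f).1 P.mono
  let f : M →ₗ[R] P.J := P.f.hom
  obtain ⟨N, hN⟩ := exists_maximal_essential (LinearMap.range f)
  obtain ⟨C, hC⟩ := exists_maximal_disjoint N
  have hcompl := isCompl_of_maximal hN hC
  refine ⟨ModuleCat.of R N, f.codRestrict N fun x => hN.prop.1 ⟨x, rfl⟩,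
    injective_of_isCompl hcompl, fun x y h => hf (congrArg Subtype.val h), fun U hU => ?_⟩
  have h1 : U.map N.subtype = ⊥ := by
    refine hN.prop.2 _ (Submodule.map_subtype_le N U) ?_
    rw [eq_bot_iff]
    rintro _ ⟨⟨z, hz, rfl⟩, m, hm⟩
    have : z ∈ U ⊓ LinearMap.range (f.codRestrict N fun x => hN.prop.1 ⟨x, rfl⟩) :=
      ⟨hz, m, Subtype.ext hm⟩
    rw [hU] at this
    have hz0 : z = 0 := by simpa using this
    simp [hz0]
  exact Submodule.map_injective_of_injective N.injective_subtype
    (h1.trans (Submodule.map_bot _).symm)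

/-! ### The duality `D` and the transpose -/

/-- The injective envelope of the `R`-module `R / rad R`. -/
def dualizingModule (R : Type u) [CommRing R] : ModuleCat.{u} R :=
  Classical.choose (exists_injectiveEnvelope R (R ⧸ (Ideal.jacobson (⊥ : Ideal R))))

theorem dualizingModule_spec (R : Type u) [CommRing R] :
    ∃ i : (R ⧸ (Ideal.jacobson (⊥ : Ideal R))) →ₗ[R] dualizingModule R,
      IsInjectiveEnvelope i :=
  Classical.choose_spec (exists_injectiveEnvelope R (R ⧸ (Ideal.jacobson (⊥ : Ideal R))))

/-- The dual `D(M) = Hom_R(M, J)` of a left `Λ`-module `M`, where `J` is the injective envelope of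
`R / rad R` and `R` acts on `M` through the structure map `R → Λ`. -/
def Dual (R Λ : Type u) [CommRing R] [Ring Λ] [Algebra R Λ] (M : Type u) [AddCommGroup M]
    [Module Λ M] : Type u :=
  RestrictScalars R Λ M →ₗ[R] dualizingModule R

section Dual

variable (R Λ : Type u) [CommRing R] [Ring Λ] [Algebra R Λ] (M : Type u) [AddCommGroup M]
  [Module Λ M]

instance : AddCommGroup (Dual R Λ M) :=
  inferInstanceAs (AddCommGroup (RestrictScalars R Λ M →ₗ[R] dualizingModule R))

/-- `D(M)` is a right `Λ`-module: `(f · a)(x) = f (a x)`. -/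
instance : Module Λᵐᵒᵖ (Dual R Λ M) where
  smul a f := LinearMap.comp (f : RestrictScalars R Λ M →ₗ[R] dualizingModule R)
    (RestrictScalars.lsmul R Λ M a.unop)
  one_smul f := LinearMap.ext fun x => congrArg f.toFun (one_smul Λ (RestrictScalars.addEquiv R Λ M x))
  mul_smul a b f := LinearMap.ext fun x => congrArg f.toFun (mul_smul b.unop a.unop (RestrictScalars.addEquiv R Λ M x))
  smul_zero _ := rfl
  smul_add _ _ _ := rfl
  add_smul a b f := LinearMap.ext fun x =>
    (congrArg f.toFun (add_smul a.unop b.unop (RestrictScalars.addEquiv R Λ M x))).trans (f.map_add _ _)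
  zero_smul f := LinearMap.ext fun x =>
    (congrArg f.toFun (zero_smul Λ (RestrictScalars.addEquiv R Λ M x))).trans f.map_zero

end Dual

/-- `p : P → M` is a projective cover: `P` is projective and `p` is an epimorphism with superfluous
kernel. -/
structure IsProjectiveCover {S : Type u} [Ring S] {P M : Type u} [AddCommGroup P] [Module S P]
    [AddCommGroup M] [Module S M] (p : P →ₗ[S] M) : Prop where
  projective : Module.Projective S P
  surjective : Function.Surjective p
  superfluous : ∀ U : Submodule S P, U ⊔ LinearMap.ker p = ⊤ → U = ⊤

/-- `P₁ → P₀ → M → 0` is a minimal projective presentation: it is exact, `P₀ → M` is a projective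
cover, and `P₁` is a projective cover of the image of `P₁ → P₀`, the kernel of `P₀ → M`. -/
structure IsMinimalPresentation {S : Type u} [Ring S] {P₁ P₀ M : Type u} [AddCommGroup P₁]
    [Module S P₁] [AddCommGroup P₀] [Module S P₀] [AddCommGroup M] [Module S M]
    (f : P₁ →ₗ[S] P₀) (p : P₀ →ₗ[S] M) : Prop where
  finite₁ : Module.Finite S P₁
  finite₀ : Module.Finite S P₀
  exact : LinearMap.range f = LinearMap.ker p
  cover₀ : IsProjectiveCover p
  cover₁ : IsProjectiveCover f.rangeRestrict

/-- For a map `f : P₁ → P₀` of right `Λ`-modules, the cokernel of the map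
`Hom(P₀, Λ) → Hom(P₁, Λ)`, `g ↦ g ∘ f`, of left `Λ`-modules. If `f` belongs to a minimal projective
presentation `P₁ → P₀ → M → 0`, then this is the transpose `Tr M`. -/
abbrev TransposeOf {Λ : Type u} [Ring Λ] {P₁ P₀ : Type u} [AddCommGroup P₁] [Module Λᵐᵒᵖ P₁]
    [AddCommGroup P₀] [Module Λᵐᵒᵖ P₀] (f : P₁ →ₗ[Λᵐᵒᵖ] P₀) : Type u :=
  (P₁ →ₗ[Λᵐᵒᵖ] Λ) ⧸ LinearMap.range (LinearMap.lcomp Λ Λ f)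

/-- The left module `N` is isomorphic to `Tr D(L)`. -/
def IsTrD (R Λ : Type u) [CommRing R] [Ring Λ] [Algebra R Λ] (L N : Type u) [AddCommGroup L]
    [Module Λ L] [AddCommGroup N] [Module Λ N] : Prop :=
  ∃ (P₁ P₀ : ModuleCat.{u} Λᵐᵒᵖ) (f : P₁ →ₗ[Λᵐᵒᵖ] P₀) (p : P₀ →ₗ[Λᵐᵒᵖ] Dual R Λ L),
    IsMinimalPresentation f p ∧ Nonempty (N ≃ₗ[Λ] TransposeOf f)

/-! ### Indecomposable modules, the intrinsic kernel -/

/-- A module is indecomposable if it is nonzero and not a direct sum of two nonzero submodules. -/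
def Indecomposable (Λ : Type u) [Ring Λ] (M : Type u) [AddCommGroup M] [Module Λ M] : Prop :=
  Nontrivial M ∧ ∀ U V : Submodule Λ M, IsCompl U V → U = ⊥ ∨ V = ⊥

section Morphisms

variable {Λ : Type u} [Ring Λ] {X Y : Type u} [AddCommGroup X] [Module Λ X]
  [AddCommGroup Y] [Module Λ Y]

/-- `α : X → Y` is right minimal: no nonzero direct summand of `X` lies in the kernel of `α`. -/
def IsRightMinimal (α : X →ₗ[Λ] Y) : Prop :=
  ∀ U V : Submodule Λ X, IsCompl U V → U ≤ LinearMap.ker α → U = ⊥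

/-- The module `K` is (isomorphic to) the intrinsic kernel of `α : X → Y`: there is a decomposition
`X = X₀ ⊕ X₁` with `X₀` contained in the kernel of `α` and `α|X₁` right minimal, and `K` is
isomorphic to the kernel of `α|X₁`. -/
def IsIntrinsicKernel (α : X →ₗ[Λ] Y) (K : Type u) [AddCommGroup K] [Module Λ K] : Prop :=
  ∃ X₀ X₁ : Submodule Λ X, IsCompl X₀ X₁ ∧ X₀ ≤ LinearMap.ker α ∧
    IsRightMinimal (α.domRestrict X₁) ∧
    Nonempty (K ≃ₗ[Λ] LinearMap.ker (α.domRestrict X₁))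

/-- The intrinsic kernel exists. -/
theorem exists_intrinsicKernel [IsNoetherian Λ X] (α : X →ₗ[Λ] Y) :
    ∃ K : ModuleCat.{u} Λ, IsIntrinsicKernel α K := by
  obtain ⟨X₀, ⟨⟨X₁, hc⟩, hk⟩, hmax⟩ := set_has_maximal_iff_noetherian.2 ‹IsNoetherian Λ X›
    {U : Submodule Λ X | (∃ V, IsCompl U V) ∧ U ≤ LinearMap.ker α} ⟨⊥, ⟨⊤, isCompl_bot_top⟩, bot_le⟩
  refine ⟨ModuleCat.of Λ (LinearMap.ker (α.domRestrict X₁)), X₀, X₁, hc, hk, ?_,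
    ⟨LinearEquiv.refl _ _⟩⟩
  intro U V hUV hU
  have hsup : U.map X₁.subtype ⊔ V.map X₁.subtype = X₁ := by
    rw [← Submodule.map_sup, hUV.sup_eq_top, Submodule.map_top, Submodule.range_subtype]
  have hinf : Disjoint (U.map X₁.subtype) (V.map X₁.subtype) := by
    rw [disjoint_iff, ← Submodule.map_inf _ X₁.injective_subtype, hUV.inf_eq_bot,
      Submodule.map_bot]
  have hUk : U.map X₁.subtype ≤ LinearMap.ker α := by
    rintro _ ⟨x, hx, rfl⟩
    exact hU hx
  have hcompl : IsCompl (X₀ ⊔ U.map X₁.subtype) (V.map X₁.subtype) := by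
    refine ⟨?_, ?_⟩
    · refine Disjoint.disjoint_sup_left_of_disjoint_sup_right hinf ?_
      rw [hsup]
      exact hc.disjoint
    · rw [codisjoint_iff, sup_assoc, hsup]
      exact hc.sup_eq_top
  have hle : U.map X₁.subtype ≤ X₀ := by
    by_contra hlt
    exact hmax _ ⟨⟨_, hcompl⟩, sup_le hk hUk⟩
      (lt_of_le_of_ne le_sup_left fun h => hlt (h ▸ le_sup_right))
  have hbot : U.map X₁.subtype = ⊥ := by
    rw [eq_bot_iff, ← hc.inf_eq_bot]
    exact le_inf hle (Submodule.map_subtype_le X₁ U)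
  exact Submodule.map_injective_of_injective X₁.injective_subtype
    (hbot.trans (Submodule.map_bot _).symm)

/-! ### Right determination -/

/-- The morphism `β : Z → Y` factors through `α : X → Y`. -/
def FactorsThrough (α : X →ₗ[Λ] Y) {Z : Type u} [AddCommGroup Z] [Module Λ Z]
    (β : Z →ₗ[Λ] Y) : Prop :=
  ∃ γ : Z →ₗ[Λ] X, α ∘ₗ γ = β

/-- `α : X → Y` is right determined by `C` (in the category of finitely generated modules). -/
def RightDetermined (α : X →ₗ[Λ] Y) (C : Type u) [AddCommGroup C] [Module Λ C] : Prop :=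
  ∀ (X' : Type u) [AddCommGroup X'] [Module Λ X'] [Module.Finite Λ X'] (α' : X' →ₗ[Λ] Y),
    (∀ φ : C →ₗ[Λ] X', FactorsThrough α (α' ∘ₗ φ)) → FactorsThrough α α'

/-- `T` is isomorphic to a direct summand of `C`. -/
def IsSummandOf (Λ : Type u) [Ring Λ] (T C : Type u) [AddCommGroup T] [Module Λ T]
    [AddCommGroup C] [Module Λ C] : Prop :=
  ∃ (i : T →ₗ[Λ] C) (r : C →ₗ[Λ] T), r ∘ₗ i = LinearMap.id

/-- `T` is a minimal right determiner for `α`: it is finitely generated, right determines `α`, and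
is a direct summand of any finitely generated module which right determines `α`. -/
structure IsMinimalRightDeterminer (α : X →ₗ[Λ] Y) (T : Type u) [AddCommGroup T]
    [Module Λ T] : Prop where
  finite : Module.Finite Λ T
  rightDetermined : RightDetermined α T
  minimal : ∀ (C : Type u) [AddCommGroup C] [Module Λ C] [Module.Finite Λ C],
    RightDetermined α C → IsSummandOf Λ T C

/-- The morphism `ψ : M → N` belongs to the radical of the category: `1 - gψ` is invertible for
all `g : N → M`. -/
def IsRadicalMap {M N : Type u} [AddCommGroup M] [Module Λ M] [AddCommGroup N] [Module Λ N]
    (ψ : M →ₗ[Λ] N) : Prop :=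
  ∀ g : N →ₗ[Λ] M, IsUnit (1 - (g ∘ₗ ψ : Module.End Λ M))

/-- The indecomposable module `N` almost factors through `α : X → Y`: there is `η : N → Y` which
does not factor through `α`, whereas `ηψ` factors through `α` for any radical map `ψ : M → N`. -/
def AlmostFactorsThrough (α : X →ₗ[Λ] Y) (N : Type u) [AddCommGroup N] [Module Λ N] : Prop :=
  Indecomposable Λ N ∧ ∃ η : N →ₗ[Λ] Y, ¬ FactorsThrough α η ∧
    ∀ (M : Type u) [AddCommGroup M] [Module Λ M] [Module.Finite Λ M] (ψ : M →ₗ[Λ] N),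
      IsRadicalMap ψ → FactorsThrough α (η ∘ₗ ψ)

variable (R : Type u) [CommRing R] [Algebra R Λ]

/-- The finitely generated module `N` is of the form `Tr D(L)` with `L` an indecomposable direct
summand of `K`, or it is an indecomposable projective module which almost factors through `α`. -/
def IsDeterminerSummand (α : X →ₗ[Λ] Y) (K : Type u) [AddCommGroup K] [Module Λ K]
    (N : Type u) [AddCommGroup N] [Module Λ N] : Prop :=
  Module.Finite Λ N ∧
    ((∃ L : Submodule Λ K, (∃ L', IsCompl L L') ∧ Indecomposable Λ L ∧ IsTrD R Λ L N) ∨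
      (Module.Projective Λ N ∧ AlmostFactorsThrough α N))

/-- The family `N` consists of the modules of the form `Tr D(L)`, with `L` an indecomposable direct
summand of `K`, and of the indecomposable projective modules which almost factor through `α`, one
from each isomorphism class. -/
structure IsDeterminerFamily (α : X →ₗ[Λ] Y) (K : Type u) [AddCommGroup K] [Module Λ K]
    {ι : Type u} (N : ι → ModuleCat.{u} Λ) : Prop where
  mem : ∀ i, IsDeterminerSummand R α K (N i)
  eq_of_iso : ∀ i j, Nonempty (N i ≃ₗ[Λ] N j) → i = j
  exists_iso : ∀ (M : Type u) [AddCommGroup M] [Module Λ M],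
    IsDeterminerSummand R α K M → ∃ i, Nonempty (M ≃ₗ[Λ] N i)

end Morphisms

end

end RightDet

namespace RightDet

noncomputable section

/-! ### Factoring linear maps -/

theorem exists_comp_eq_of_ker_le_ker {S A B C : Type*} [Ring S] [AddCommGroup A] [Module S A]
    [AddCommGroup B] [Module S B] [AddCommGroup C] [Module S C] {g : A →ₗ[S] B}
    (hg : Function.Surjective g) {u : A →ₗ[S] C} (h : LinearMap.ker g ≤ LinearMap.ker u) :
    ∃ v : B →ₗ[S] C, v ∘ₗ g = u := by
  refine ⟨(LinearMap.ker g).liftQ u h ∘ₗ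
    (g.quotKerEquivOfSurjective hg).symm.toLinearMap, LinearMap.ext fun n => ?_⟩
  have : (g.quotKerEquivOfSurjective hg).symm (g n) = (LinearMap.ker g).mkQ n := by
    rw [LinearEquiv.symm_apply_eq]
    rfl
  simp [this]

theorem exists_comp_eq_of_range_le_range {S P B C : Type*} [Ring S] [AddCommGroup P] [Module S P]
    [AddCommGroup B] [Module S B] [AddCommGroup C] [Module S C] [Module.Projective S P]
    {f : B →ₗ[S] C} {g : P →ₗ[S] C} (h : LinearMap.range g ≤ LinearMap.range f) :
    ∃ k : P →ₗ[S] B, f ∘ₗ k = g := by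
  obtain ⟨k, hk⟩ := Module.projective_lifting_property f.rangeRestrict
    (g.codRestrict (LinearMap.range f) fun x => h ⟨x, rfl⟩) f.surjective_rangeRestrict
  exact ⟨k, LinearMap.ext fun x => congrArg Subtype.val (LinearMap.congr_fun hk x)⟩

theorem exists_comp_eq_of_range_le_range_of_injective {S A B C : Type*} [Ring S] [AddCommGroup A]
    [Module S A] [AddCommGroup B] [Module S B] [AddCommGroup C] [Module S C]
    {f : B →ₗ[S] C} (hf : Function.Injective f) {g : A →ₗ[S] C}
    (h : LinearMap.range g ≤ LinearMap.range f) : ∃ k : A →ₗ[S] B, f ∘ₗ k = g := by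
  let e := LinearEquiv.ofInjective f hf
  refine ⟨e.symm.toLinearMap ∘ₗ g.codRestrict (LinearMap.range f) fun x => h ⟨x, rfl⟩,
    LinearMap.ext fun x => ?_⟩
  exact congrArg Subtype.val (e.apply_symm_apply ⟨g x, h ⟨x, rfl⟩⟩)

/-! ### Duality over a commutative artinian ring -/

section Duality

variable (R : Type u) [CommRing R]

theorem dualizingModule_injective : Module.Injective R (dualizingModule R) := by
  obtain ⟨i, hi⟩ := dualizingModule_spec R
  exact hi.injective_module

variable [IsArtinianRing R]

theorem isSemisimpleRing_quotient_jacobson :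
    IsSemisimpleRing (R ⧸ (Ideal.jacobson (⊥ : Ideal R))) := by
  have h : Ideal.jacobson (⊥ : Ideal R) = Ring.jacobson R := Ring.jacobson_eq_sInf_isMaximal R ▸ by
    simp [Ideal.jacobson]
  rw [h]
  exact IsSemiprimaryRing.isSemisimpleRing

/-- The semisimple ring `R / rad R` is a principal ideal ring, so its `m`-torsion is generated by
one element. Essentiality moves all `m`-torsion of `J` into `R / rad R`: a nonzero torsion `y` has a
nonzero multiple `s • y` there, and `s` is invertible modulo `m`. -/
theorem dualizingModule_torsion_cyclic (m : Ideal R) [hm : m.IsMaximal] :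
    ∃ x : dualizingModule R, (∀ r ∈ m, r • x = 0) ∧
      ∀ y : dualizingModule R, (∀ r ∈ m, r • y = 0) → ∃ r : R, y = r • x := by
  obtain ⟨i, hi⟩ := dualizingModule_spec R
  have := isSemisimpleRing_quotient_jacobson R
  let I : Ideal (R ⧸ (Ideal.jacobson (⊥ : Ideal R))) :=
    { carrier := {z | ∀ r ∈ m, r • z = 0}
      add_mem' := fun {a b} ha hb r hr => by rw [smul_add, ha r hr, hb r hr, add_zero]
      zero_mem' := fun r _ => smul_zero r
      smul_mem' := fun c z hz r hr => by
        rw [smul_eq_mul, ← mul_smul_comm, hz r hr, mul_zero] }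
  obtain ⟨a, ha⟩ := (IsPrincipalIdealRing.principal I).principal
  have haI : a ∈ I := ha ▸ Submodule.mem_span_singleton_self a
  refine ⟨i a, fun r hr => by rw [← map_smul, haI r hr, map_zero], fun y hy => ?_⟩
  by_cases hy0 : y = 0
  · exact ⟨0, by rw [hy0, zero_smul]⟩
  have hne : Submodule.span R {y} ⊓ LinearMap.range i ≠ ⊥ := fun h =>
    hy0 (Submodule.span_singleton_eq_bot.1 (hi.essential _ h))
  obtain ⟨w, ⟨hw, z, rfl⟩, hw0⟩ := Submodule.exists_mem_ne_zero_of_ne_bot hne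
  obtain ⟨s, hs⟩ := Submodule.mem_span_singleton.1 hw
  have hsm : s ∉ m := fun h => hw0 (hs ▸ hy s h)
  obtain ⟨t, ht⟩ := hm.exists_inv hsm
  obtain ⟨k, hk, htk⟩ := ht
  have hyz : y = i (t • z) := by
    rw [map_smul, ← hs, smul_smul]
    conv_lhs => rw [← one_smul R y, ← htk, add_smul, hy k hk, add_zero]
  have hzI : t • z ∈ I := fun r hr => hi.injective (by
    rw [map_smul, ← hyz, hy r hr, map_zero])
  rw [ha] at hzI
  obtain ⟨c, hc⟩ := Submodule.mem_span_singleton.1 hzI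
  obtain ⟨r, rfl⟩ := Ideal.Quotient.mk_surjective c
  refine ⟨r, ?_⟩
  rw [hyz, ← hc, ← map_smul]
  rfl

theorem dualizingModule_torsion_ne_zero (m : Ideal R) [hm : m.IsMaximal] :
    ∃ x : dualizingModule R, x ≠ 0 ∧ ∀ r ∈ m, r • x = 0 := by
  obtain ⟨i, hi⟩ := dualizingModule_spec R
  have := isSemisimpleRing_quotient_jacobson R
  let π := Ideal.Quotient.mk (Ideal.jacobson (⊥ : Ideal R))
  have hJm : Ideal.jacobson (⊥ : Ideal R) ≤ m := by
    rw [Ideal.jacobson]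
    exact sInf_le ⟨bot_le, hm⟩
  obtain ⟨I', hI'⟩ := exists_isCompl (m.map π)
  have hne : I' ≠ ⊥ := by
    rintro rfl
    have htop : m.map π = ⊤ := by simpa using hI'.sup_eq_top
    have h1 : (1 : R) ∈ (m.map π).comap π := by rw [htop]; trivial
    rw [Ideal.comap_map_of_surjective' π Ideal.Quotient.mk_surjective, Ideal.mk_ker,
      sup_eq_left.2 hJm] at h1
    exact hm.ne_top ((Ideal.eq_top_iff_one _).2 h1)
  obtain ⟨z, hz, hz0⟩ := Submodule.exists_mem_ne_zero_of_ne_bot hne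
  refine ⟨i z, fun h => hz0 (hi.injective (h.trans (map_zero i).symm)), fun r hr => ?_⟩
  rw [← map_smul]
  have h1 : r • z ∈ m.map π ⊓ I' := by
    have : r • z = π r * z := rfl
    rw [this]
    exact ⟨Ideal.mul_mem_right _ _ (Ideal.mem_map_of_mem π hr), Ideal.mul_mem_left _ _ hz⟩
  rw [hI'.inf_eq_bot] at h1
  rw [(Submodule.mem_bot _).1 h1, map_zero]

/-- `J` is a cogenerator. -/
theorem exists_functional_ne_zero {V : Type u} [AddCommGroup V] [Module R V] {v : V} (hv : v ≠ 0) :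
    ∃ μ : V →ₗ[R] dualizingModule R, μ v ≠ 0 := by
  have := dualizingModule_injective R
  let k := LinearMap.ker (LinearMap.toSpanSingleton R V v)
  have hk : k ≠ ⊤ := fun h => hv (by
    have h1 : (1 : R) ∈ k := by rw [h]; trivial
    simpa [k] using h1)
  obtain ⟨m, hm, hkm⟩ := Ideal.exists_le_maximal k hk
  obtain ⟨x, hx0, hx⟩ := dualizingModule_torsion_ne_zero R m
  let f : (R ⧸ k) →ₗ[R] V := k.liftQ (LinearMap.toSpanSingleton R V v) le_rfl
  have hf : Function.Injective f := LinearMap.ker_eq_bot.1 (by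
    exact Submodule.ker_liftQ_eq_bot _ _ _ le_rfl)
  let g : (R ⧸ k) →ₗ[R] dualizingModule R :=
    k.liftQ (LinearMap.toSpanSingleton R _ x) fun r hr => hx r (hkm hr)
  obtain ⟨μ, hμ⟩ := Module.Injective.out f hf g
  refine ⟨μ, ?_⟩
  have h1 := hμ (k.mkQ 1)
  have h2 : f (k.mkQ 1) = v := one_smul R v
  have h3 : g (k.mkQ 1) = x := one_smul R x
  rw [h2, h3] at h1
  rwa [h1]

/-- Induction along a filtration with factors `R / p`, where `p` is maximal since `R` is artinian.
For such a factor the dual is cyclic because the `p`-torsion of `J` is; extensions are handled by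
exactness of `Hom(-, J)`. -/
theorem bidual_surjective_and_isNoetherian (V : Type u) [AddCommGroup V] [Module R V]
    [hV : Module.Finite R V] :
    (∀ ω : (V →ₗ[R] dualizingModule R) →ₗ[R] dualizingModule R, ∃ v, ∀ u, ω u = u v) ∧
      IsNoetherian R (V →ₗ[R] dualizingModule R) := by
  have := dualizingModule_injective R
  induction hV using IsNoetherianRing.induction_on_isQuotientEquivQuotientPrime R with
  | subsingleton N =>
    refine ⟨fun ω => ⟨0, fun u => ?_⟩, ?_⟩
    · rw [map_zero, Subsingleton.elim u 0, map_zero]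
    · infer_instance
  | quotient N p e =>
    have hm : p.1.IsMaximal := inferInstance
    obtain ⟨x, hx, hcyc⟩ := dualizingModule_torsion_cyclic R p.1
    let w : N := e.symm (p.1.mkQ 1)
    have hw : ∀ r ∈ p.1, r • w = 0 := fun r hr => by
      have h : r • p.1.mkQ 1 = 0 := by
        rw [← map_smul, smul_eq_mul, mul_one]
        exact (Submodule.Quotient.mk_eq_zero _).2 hr
      rw [← map_smul, h, map_zero]
    have hgen : ∀ n : N, ∃ r : R, n = r • w := fun n => by
      obtain ⟨r, hr⟩ := p.1.mkQ_surjective (e n)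
      refine ⟨r, e.injective ?_⟩
      rw [← hr, map_smul]
      simp only [w, LinearEquiv.apply_symm_apply]
      rw [← p.1.mkQ.map_smul, smul_eq_mul, mul_one]
    let u₀ : N →ₗ[R] dualizingModule R :=
      (p.1.liftQ (LinearMap.toSpanSingleton R _ x) fun r hr => hx r hr) ∘ₗ
        e.toLinearMap
    have hu₀ : u₀ w = x := by
      simp only [u₀, w, LinearMap.comp_apply, LinearEquiv.coe_coe, LinearEquiv.apply_symm_apply]
      exact one_smul R x
    have hspan : ∀ u : N →ₗ[R] dualizingModule R, ∃ r : R, u = r • u₀ := fun u => by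
      obtain ⟨r, hr⟩ := hcyc (u w) fun s hs => by rw [← map_smul, hw s hs, map_zero]
      refine ⟨r, LinearMap.ext fun n => ?_⟩
      obtain ⟨t, rfl⟩ := hgen n
      rw [map_smul, hr, LinearMap.smul_apply, map_smul, hu₀, smul_comm]
    refine ⟨fun ω => ?_, ?_⟩
    · obtain ⟨r, hr⟩ := hcyc (ω u₀) fun s hs => by
        have : s • u₀ = 0 := LinearMap.ext fun n => by
          obtain ⟨t, rfl⟩ := hgen n
          rw [LinearMap.smul_apply, map_smul, hu₀, smul_comm, hx s hs, smul_zero,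
            LinearMap.zero_apply]
        rw [← map_smul, this, map_zero]
      refine ⟨r • w, fun u => ?_⟩
      obtain ⟨t, rfl⟩ := hspan u
      rw [map_smul, hr, LinearMap.smul_apply, map_smul, hu₀]
    · have : Module.Finite R (N →ₗ[R] dualizingModule R) := by
        refine ⟨⟨{u₀}, ?_⟩⟩
        rw [Finset.coe_singleton, eq_top_iff]
        intro u _
        obtain ⟨t, rfl⟩ := hspan u
        exact Submodule.smul_mem _ _ (Submodule.mem_span_singleton_self _)
      infer_instance
  | exact N₁ N₂ N₃ f g hf hg hfg h₁ h₃ =>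
    obtain ⟨h₁, hn₁⟩ := h₁
    obtain ⟨h₃, hn₃⟩ := h₃
    have hres : ∀ u₁ : N₁ →ₗ[R] dualizingModule R, ∃ u₂ : N₂ →ₗ[R] dualizingModule R,
        u₂ ∘ₗ f = u₁ := fun u₁ => by
      obtain ⟨u₂, hu₂⟩ := Module.Injective.out f hf u₁
      exact ⟨u₂, LinearMap.ext hu₂⟩
    have hker : ∀ u₂ : N₂ →ₗ[R] dualizingModule R, u₂ ∘ₗ f = 0 →
        ∃ u₃ : N₃ →ₗ[R] dualizingModule R, u₃ ∘ₗ g = u₂ := fun u₂ hu₂ => by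
      refine exists_comp_eq_of_ker_le_ker hg ?_
      rw [LinearMap.exact_iff.1 hfg]
      rintro _ ⟨n, rfl⟩
      exact LinearMap.congr_fun hu₂ n
    refine ⟨fun ω => ?_, ?_⟩
    · obtain ⟨v₃, hv₃⟩ := h₃ (ω ∘ₗ LinearMap.lcomp R _ g)
      obtain ⟨v, rfl⟩ := hg v₃
      choose s hs using hres
      have hω : ∀ u₂, u₂ ∘ₗ f = 0 → ω u₂ = u₂ v := fun u₂ hu₂ => by
        obtain ⟨u₃, rfl⟩ := hker u₂ hu₂
        exact hv₃ u₃
      have hω' : ∀ u u', u ∘ₗ f = u' ∘ₗ f → ω u - u v = ω u' - u' v := fun u u' h => by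
        have := hω (u - u') (by rw [LinearMap.sub_comp, h, sub_self])
        rw [map_sub, LinearMap.sub_apply] at this
        rw [sub_eq_sub_iff_sub_eq_sub, this]
      -- After subtracting evaluation at `v`, the functional depends only on restrictions to `N₁`,
      -- so it descends to the dual of `N₁`. The chosen extension `s` need not be linear.
      let ω₁ : (N₁ →ₗ[R] dualizingModule R) →ₗ[R] dualizingModule R :=
        { toFun := fun u₁ => ω (s u₁) - s u₁ v
          map_add' := fun a b => by
            rw [hω' (s (a + b)) (s a + s b) (by rw [hs, LinearMap.add_comp, hs, hs]), map_add,
              LinearMap.add_apply]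
            abel
          map_smul' := fun r a => by
            rw [hω' (s (r • a)) (r • s a) (by rw [hs, LinearMap.smul_comp, hs]), map_smul,
              LinearMap.smul_apply, ← smul_sub, RingHom.id_apply] }
      obtain ⟨v₁, hv₁⟩ := h₁ ω₁
      refine ⟨v + f v₁, fun u => ?_⟩
      have h1 : ω u - u v = ω₁ (u ∘ₗ f) := hω' _ _ (hs (u ∘ₗ f)).symm
      rw [hv₁, sub_eq_iff_eq_add] at h1
      rw [h1, map_add, add_comm]
      rfl
    · refine isNoetherian_of_range_eq_ker (LinearMap.lcomp R (dualizingModule R) g)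
        (LinearMap.lcomp R (dualizingModule R) f) ?_
      apply le_antisymm
      · rintro _ ⟨u, rfl⟩
        refine LinearMap.ext fun n => ?_
        change u (g (f n)) = 0
        rw [hfg.apply_apply_eq_zero, map_zero]
      · intro u hu
        obtain ⟨u₃, rfl⟩ := hker u hu
        exact ⟨u₃, rfl⟩

theorem exists_eval_eq {V : Type u} [AddCommGroup V] [Module R V] [Module.Finite R V]
    (ω : (V →ₗ[R] dualizingModule R) →ₗ[R] dualizingModule R) : ∃ v, ∀ u, ω u = u v :=
  (bidual_surjective_and_isNoetherian R V).1 ω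

end Duality

/-! ### Indecomposable modules and local endomorphism rings -/

section Local

variable {S : Type u} [Ring S] {M : Type u} [AddCommGroup M] [Module S M]

/-- Fitting: `M` is the sum of the kernel and the range of a high power of `k`. The range lies in
the superfluous `K`, so the kernel is everything. The exponent `n + 1` keeps the power positive. -/
theorem isNilpotent_of_range_le_superfluous [IsNoetherian S M] [IsArtinian S M]
    (k : Module.End S M) (K : Submodule S M) (hK : ∀ U : Submodule S M, U ⊔ K = ⊤ → U = ⊤)
    (hk : LinearMap.range k ≤ K) : IsNilpotent k := by
  obtain ⟨n, hn⟩ := Filter.eventually_atTop.1 k.eventually_isCompl_ker_pow_range_pow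
  have h := hn (n + 1) (Nat.le_succ n)
  refine ⟨n + 1, LinearMap.ker_eq_top.1 (hK _ (eq_top_iff.2 ?_))⟩
  rw [← h.sup_eq_top]
  refine sup_le_sup_left (le_trans ?_ hk) _
  rw [pow_succ', Module.End.mul_eq_comp]
  exact LinearMap.range_comp_le_range _ _

theorem Indecomposable.isUnit_or_isNilpotent [IsNoetherian S M] [IsArtinian S M]
    (hM : Indecomposable S M) (f : Module.End S M) : IsUnit f ∨ IsNilpotent f := by
  obtain ⟨n, hn⟩ := Filter.eventually_atTop.1 f.eventually_isCompl_ker_pow_range_pow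
  have h := hn (n + 1) (Nat.le_succ n)
  rcases hM.2 _ _ h with h0 | h0
  · left
    rw [h0] at h
    have htop : LinearMap.range (f ^ (n + 1)) = ⊤ := by simpa using h.sup_eq_top
    have hu : IsUnit (f ^ (n + 1)) := (Module.End.isUnit_iff _).2
      ⟨LinearMap.ker_eq_bot.1 h0, LinearMap.range_eq_top.1 htop⟩
    exact (isUnit_pow_iff (Nat.succ_ne_zero n)).1 hu
  · right
    exact ⟨n + 1, LinearMap.range_eq_bot.1 h0⟩

theorem isLocalRing_end_of_isUnit_or_isNilpotent [Nontrivial M]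
    (h : ∀ f : Module.End S M, IsUnit f ∨ IsNilpotent f) : IsLocalRing (Module.End S M) where
  isUnit_or_isUnit_of_add_one {a b} hab := by
    rcases h a with ha | ha
    · exact Or.inl ha
    · right
      rw [← eq_sub_iff_add_eq'] at hab
      rw [hab]
      exact ha.isUnit_one_sub

theorem Indecomposable.isLocalRing [IsNoetherian S M] [IsArtinian S M]
    (hM : Indecomposable S M) : IsLocalRing (Module.End S M) :=
  have := hM.1
  isLocalRing_end_of_isUnit_or_isNilpotent hM.isUnit_or_isNilpotent

theorem isUnit_or_isUnit_of_isUnit_add {A : Type*} [Ring A] [IsLocalRing A] {a b : A}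
    (h : IsUnit (a + b)) : IsUnit a ∨ IsUnit b := by
  obtain ⟨w, hw⟩ := h
  have h1 : (↑w⁻¹ : A) * a + ↑w⁻¹ * b = 1 := by rw [← mul_add, ← hw, Units.inv_mul]
  rcases IsLocalRing.isUnit_or_isUnit_of_add_one h1 with h | h
  · exact Or.inl ((Units.isUnit_units_mul _ _).1 h)
  · exact Or.inr ((Units.isUnit_units_mul _ _).1 h)

theorem exists_isUnit_of_isUnit_list_sum {A : Type*} [Ring A] [IsLocalRing A] (l : List A)
    (h : IsUnit l.sum) : ∃ a ∈ l, IsUnit a := by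
  induction l with
  | nil => simp at h
  | cons a l ih =>
    rw [List.sum_cons] at h
    rcases isUnit_or_isUnit_of_isUnit_add h with h | h
    · exact ⟨a, List.mem_cons_self, h⟩
    · obtain ⟨b, hb, hu⟩ := ih h
      exact ⟨b, List.mem_cons_of_mem _ hb, hu⟩

theorem eq_one_of_isIdempotentElem_of_range_eq_top {q : Module.End S M} (hq : IsIdempotentElem q)
    (h : LinearMap.range q = ⊤) : q = 1 := by
  ext x
  obtain ⟨y, rfl⟩ := LinearMap.range_eq_top.1 h x
  exact LinearMap.congr_fun hq y

theorem Indecomposable.eq_zero_or_eq_one (hM : Indecomposable S M) {q : Module.End S M}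
    (hq : IsIdempotentElem q) : q = 0 ∨ q = 1 := by
  have h : IsCompl (LinearMap.range q) (LinearMap.ker q) := LinearMap.IsIdempotentElem.isCompl hq
  rcases hM.2 _ _ h with h0 | h0
  · exact Or.inl (LinearMap.range_eq_bot.1 h0)
  · right
    apply eq_one_of_isIdempotentElem_of_range_eq_top hq
    simpa [h0] using h.sup_eq_top

theorem indecomposable_of_isIdempotentElem [Nontrivial M]
    (h : ∀ q : Module.End S M, IsIdempotentElem q → q = 0 ∨ q = 1) : Indecomposable S M := by
  refine ⟨inferInstance, fun U V hUV => ?_⟩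
  let q : Module.End S M := U.subtype ∘ₗ Submodule.projectionOnto U V hUV
  have hqU : ∀ x ∈ U, q x = x := fun x hx =>
    congrArg Subtype.val (Submodule.projectionOnto_apply_left hUV ⟨x, hx⟩)
  have hqV : ∀ x ∈ V, q x = 0 := fun x hx => by
    have : Submodule.projectionOnto U V hUV x = 0 :=
      (Submodule.projectionOnto_apply_eq_zero_iff hUV).2 hx
    simp [q, this]
  have hq : IsIdempotentElem q := LinearMap.ext fun x => hqU _ (Subtype.property _)
  rcases h q hq with h | h
  · left
    rw [eq_bot_iff]
    intro x hx
    rw [← hqU x hx, h]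
    simp
  · right
    rw [eq_bot_iff]
    intro x hx
    have := hqV x hx
    rw [h] at this
    simpa using this

theorem indecomposable_of_isLocalRing [IsLocalRing (Module.End S M)] : Indecomposable S M := by
  have : Nontrivial M := by
    by_contra h
    rw [not_nontrivial_iff_subsingleton] at h
    exact zero_ne_one (α := Module.End S M) (LinearMap.ext fun x => Subsingleton.elim _ _)
  apply indecomposable_of_isIdempotentElem
  intro q hq
  rcases isUnit_or_isUnit_of_isUnit_add (a := q) (b := 1 - q) (by simp) with h | h
  · right
    exact h.mul_left_cancel (hq.trans (mul_one q).symm)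
  · left
    have := h.mul_left_cancel (hq.one_sub.trans (mul_one (1 - q)).symm)
    simpa using this

/-- The identity of a module of finite length is a finite sum of idempotents with indecomposable
images. -/
theorem exists_indecomposable_idempotents [IsArtinian S M] :
    ∃ l : List (Module.End S M),
      (∀ e ∈ l, IsIdempotentElem e ∧ Indecomposable S (LinearMap.range e)) ∧ l.sum = 1 := by
  -- Well-founded induction on the image of an idempotent: a nontrivial idempotent `q` of that image
  -- writes `e` as a sum of two idempotents with strictly smaller images, those of `q` and `1 - q`.
  suffices H : ∀ (U : Submodule S M) (e : Module.End S M), IsIdempotentElem e →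
      LinearMap.range e = U → ∃ l : List (Module.End S M),
      (∀ e ∈ l, IsIdempotentElem e ∧ Indecomposable S (LinearMap.range e)) ∧ l.sum = e from
    H _ 1 IsIdempotentElem.one rfl
  intro U
  induction U using WellFoundedLT.induction with
  | ind U ih =>
    rintro e he rfl
    by_cases hind : Indecomposable S (LinearMap.range e)
    · exact ⟨[e], by simp [he, hind], by simp⟩
    by_cases hsub : Subsingleton (LinearMap.range e)
    · refine ⟨[], by simp, ?_⟩
      rw [Submodule.subsingleton_iff_eq_bot] at hsub
      rw [LinearMap.range_eq_bot.1 hsub, List.sum_nil]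
    rw [not_subsingleton_iff_nontrivial] at hsub
    obtain ⟨q, hq, hq0, hq1⟩ : ∃ q : Module.End S (LinearMap.range e), IsIdempotentElem q ∧
        q ≠ 0 ∧ q ≠ 1 := by
      by_contra! h
      exact hind (indecomposable_of_isIdempotentElem fun q hq => or_iff_not_imp_left.2 (h q hq))
    have hsplit : ∀ q : Module.End S (LinearMap.range e), IsIdempotentElem q → q ≠ 1 →
        ∃ l : List (Module.End S M),
        (∀ e ∈ l, IsIdempotentElem e ∧ Indecomposable S (LinearMap.range e)) ∧
          l.sum = (LinearMap.range e).subtype ∘ₗ q ∘ₗ e.rangeRestrict := by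
      intro q hq hq1
      refine ih _ ?_ _ ?_ rfl
      · refine lt_of_le_of_ne ?_ ?_
        · rintro _ ⟨x, rfl⟩
          exact Subtype.property _
        · intro h
          apply hq1
          apply eq_one_of_isIdempotentElem_of_range_eq_top hq
          rw [eq_top_iff]
          rintro ⟨x, hx⟩ -
          rw [← h] at hx
          obtain ⟨y, hy⟩ := hx
          exact ⟨e.rangeRestrict y, Subtype.ext hy⟩
      · refine LinearMap.ext fun x => ?_
        have hre : ∀ y : LinearMap.range e, e.rangeRestrict y = y := by
          rintro ⟨_, z, rfl⟩
          exact Subtype.ext (LinearMap.congr_fun he z)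
        change ((q (e.rangeRestrict (q (e.rangeRestrict x)))) : M) = q (e.rangeRestrict x)
        rw [hre]
        exact congrArg Subtype.val (LinearMap.congr_fun hq _)
    obtain ⟨l₁, h₁, hs₁⟩ := hsplit q hq hq1
    obtain ⟨l₂, h₂, hs₂⟩ := hsplit (1 - q) hq.one_sub (by simpa using hq0)
    refine ⟨l₁ ++ l₂, fun f hf => ?_, ?_⟩
    · rcases List.mem_append.1 hf with hf | hf
      exacts [h₁ f hf, h₂ f hf]
    · rw [List.sum_append, hs₁, hs₂]
      ext x
      simp

end Local

/-! ### Direct summands -/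

section Summand

variable {S : Type u} [Ring S]

theorem IsSummandOf.of_isUnit {N C : Type u} [AddCommGroup N] [Module S N] [AddCommGroup C]
    [Module S C] (i : N →ₗ[S] C) (r : C →ₗ[S] N) (h : IsUnit (r ∘ₗ i : Module.End S N)) :
    IsSummandOf S N C := by
  obtain ⟨w, hw⟩ := h
  refine ⟨i, (↑w⁻¹ : Module.End S N) ∘ₗ r, ?_⟩
  rw [LinearMap.comp_assoc, ← hw]
  exact w.inv_mul

theorem IsSummandOf.trans {N C D : Type u} [AddCommGroup N] [Module S N] [AddCommGroup C]
    [Module S C] [AddCommGroup D] [Module S D] (h : IsSummandOf S N C) (h' : IsSummandOf S C D) :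
    IsSummandOf S N D := by
  obtain ⟨i, r, hir⟩ := h
  obtain ⟨i', r', hir'⟩ := h'
  refine ⟨i' ∘ₗ i, r ∘ₗ r', ?_⟩
  rw [LinearMap.comp_assoc, ← LinearMap.comp_assoc i, hir', LinearMap.id_comp, hir]

theorem IsSummandOf.nonempty_equiv {N C : Type u} [AddCommGroup N] [Module S N] [AddCommGroup C]
    [Module S C] [Nontrivial N] (hC : Indecomposable S C) (h : IsSummandOf S N C) :
    Nonempty (N ≃ₗ[S] C) := by
  obtain ⟨i, r, hir⟩ := h
  have hid : IsIdempotentElem (i ∘ₗ r : Module.End S C) := by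
    change (i ∘ₗ r) ∘ₗ (i ∘ₗ r) = i ∘ₗ r
    rw [LinearMap.comp_assoc, ← LinearMap.comp_assoc r, hir, LinearMap.id_comp]
  rcases hC.eq_zero_or_eq_one hid with h | h
  · exfalso
    obtain ⟨x, hx⟩ := exists_ne (0 : N)
    apply hx
    have h1 : i (r (i x)) = 0 := LinearMap.congr_fun h (i x)
    have h2 : ∀ y, r (i y) = y := LinearMap.congr_fun hir
    rw [← h2 x, ← h2 (r (i x)), h1, map_zero]
  · exact ⟨LinearEquiv.ofLinearMap i r h hir⟩

/-- A module with local endomorphism ring which is a direct summand of a module of finite length is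
isomorphic to one of the summands in a decomposition into indecomposables. -/
theorem IsSummandOf.exists_equiv_range {N C : Type u} [AddCommGroup N] [Module S N]
    [AddCommGroup C] [Module S C] [IsLocalRing (Module.End S N)] (h : IsSummandOf S N C)
    {l : List (Module.End S C)}
    (hl : ∀ e ∈ l, IsIdempotentElem e ∧ Indecomposable S (LinearMap.range e)) (hs : l.sum = 1) :
    ∃ e ∈ l, Nonempty (N ≃ₗ[S] LinearMap.range e) := by
  obtain ⟨i, r, hir⟩ := h
  let F : Module.End S C →+ Module.End S N :=
    { toFun := fun e => r ∘ₗ e ∘ₗ i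
      map_zero' := by simp
      map_add' := fun a b => by rw [LinearMap.add_comp, LinearMap.comp_add] }
  -- The terms `r e i` sum to `r i = 1`, so in the local ring `End N` one of them is a unit.
  have hF : IsUnit (l.map F).sum := by
    rw [← map_list_sum, hs]
    have : F 1 = 1 := hir
    rw [this]
    exact isUnit_one
  obtain ⟨_, ha, hu⟩ := exists_isUnit_of_isUnit_list_sum _ hF
  obtain ⟨e, he, rfl⟩ := List.mem_map.1 ha
  have hN : Indecomposable S N := indecomposable_of_isLocalRing
  have := hN.1
  exact ⟨e, he, (IsSummandOf.of_isUnit (e.rangeRestrict ∘ₗ i)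
    (r ∘ₗ (LinearMap.range e).subtype) hu).nonempty_equiv (hl e he).2⟩

-- An exchange argument: split off `N i₀` and show that each other `N j` is a summand of the
-- complement `ker b₀`. The identity of `N j` is a sum of a part through `N i₀` and a part through
-- `ker b₀`. The former cannot be a unit, since that would give `N j ≃ N i₀`.
open Classical in
theorem exists_orthogonal_maps {ι : Type u} (N : ι → Type u) [∀ i, AddCommGroup (N i)]
    [∀ i, Module S (N i)] (hloc : ∀ i, IsLocalRing (Module.End S (N i)))
    (hiso : ∀ i j, Nonempty (N i ≃ₗ[S] N j) → i = j) (s : Finset ι) :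
    ∀ (C : Type u) [AddCommGroup C] [Module S C], (∀ i ∈ s, IsSummandOf S (N i) C) →
    ∃ (a : ∀ i, N i →ₗ[S] C) (b : ∀ i, C →ₗ[S] N i), (∀ i ∈ s, b i ∘ₗ a i = LinearMap.id) ∧
      ∀ i ∈ s, ∀ j ∈ s, i ≠ j → b i ∘ₗ a j = 0 := by
  induction s using Finset.induction_on with
  | empty => exact fun C _ _ _ => ⟨fun _ => 0, fun _ => 0, by simp, by simp⟩
  | insert i₀ s hi₀ ih =>
    intro C _ _ hC
    obtain ⟨a₀, b₀, h₀⟩ := hC i₀ (Finset.mem_insert_self _ _)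
    have h₀' : ∀ x, b₀ (a₀ x) = x := LinearMap.congr_fun h₀
    let π : C →ₗ[S] LinearMap.ker b₀ :=
      (LinearMap.id - a₀ ∘ₗ b₀).codRestrict _ fun x => by simp [h₀']
    have hπ : ∀ x, (π x : C) = x - a₀ (b₀ x) := fun x => rfl
    have hsum : ∀ j ∈ s, IsSummandOf S (N j) (LinearMap.ker b₀) := by
      intro j hj
      obtain ⟨i, r, hir⟩ := hC j (Finset.mem_insert_of_mem hj)
      have := hloc j
      have hu : IsUnit ((r ∘ₗ a₀ ∘ₗ b₀ ∘ₗ i) + (r ∘ₗ (LinearMap.ker b₀).subtype ∘ₗ π ∘ₗ i) :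
          Module.End S (N j)) := by
        have : (r ∘ₗ a₀ ∘ₗ b₀ ∘ₗ i) + (r ∘ₗ (LinearMap.ker b₀).subtype ∘ₗ π ∘ₗ i) =
            (1 : Module.End S (N j)) := by
          refine LinearMap.ext fun x => ?_
          have := LinearMap.congr_fun hir x
          simpa [hπ] using this
        rw [this]
        exact isUnit_one
      rcases isUnit_or_isUnit_of_isUnit_add hu with hu | hu
      · exfalso
        have hj' : Indecomposable S (N j) := indecomposable_of_isLocalRing
        have := hj'.1
        have := hloc i₀
        have := (IsSummandOf.of_isUnit (b₀ ∘ₗ i) (r ∘ₗ a₀) hu).nonempty_equiv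
          indecomposable_of_isLocalRing
        exact hi₀ (hiso _ _ this ▸ hj)
      · exact IsSummandOf.of_isUnit (π ∘ₗ i) (r ∘ₗ (LinearMap.ker b₀).subtype) hu
    obtain ⟨a, b, hab, hab'⟩ := ih _ hsum
    have hπι : ∀ x : LinearMap.ker b₀, π x = x := fun x => Subtype.ext (by
      rw [hπ, show b₀ x = 0 from x.2, map_zero, sub_zero])
    have hπa : ∀ x, π (a₀ x) = 0 := fun x => Subtype.ext (by
      rw [hπ, h₀', sub_self]; rfl)
    have hne : ∀ j ∈ s, j ≠ i₀ := fun j hj h => hi₀ (h ▸ hj)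
    refine ⟨Function.update (fun i => (LinearMap.ker b₀).subtype ∘ₗ a i) i₀ a₀,
      Function.update (fun i => b i ∘ₗ π) i₀ b₀, fun i hi => ?_, fun i hi j hj hij => ?_⟩
    · rcases Finset.mem_insert.1 hi with rfl | hi
      · simpa using h₀
      · rw [Function.update_of_ne (hne i hi), Function.update_of_ne (hne i hi)]
        refine LinearMap.ext fun x => ?_
        simpa [hπι] using LinearMap.congr_fun (hab i hi) x
    · rcases Finset.mem_insert.1 hi with rfl | hi
      · rw [Function.update_self, Function.update_of_ne hij.symm]
        exact LinearMap.ext fun x => (a j x).2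
      · rw [Function.update_of_ne (hne i hi)]
        rcases Finset.mem_insert.1 hj with rfl | hj
        · rw [Function.update_self]
          exact LinearMap.ext fun x => by simp [hπa]
        · rw [Function.update_of_ne (hne j hj)]
          refine LinearMap.ext fun x => ?_
          simpa [hπι] using LinearMap.congr_fun (hab' i hi j hj hij) x

theorem isSummandOf_directSum {ι : Type u} [Finite ι] (N : ι → Type u) [∀ i, AddCommGroup (N i)]
    [∀ i, Module S (N i)] (hloc : ∀ i, IsLocalRing (Module.End S (N i)))
    (hiso : ∀ i j, Nonempty (N i ≃ₗ[S] N j) → i = j)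
    {C : Type u} [AddCommGroup C] [Module S C] (hC : ∀ i, IsSummandOf S (N i) C) :
    IsSummandOf S (⨁ i, N i) C := by
  classical
  have := Fintype.ofFinite ι
  obtain ⟨a, b, hab, hab'⟩ := exists_orthogonal_maps N hloc hiso Finset.univ C fun i _ => hC i
  refine ⟨DirectSum.toModule S ι C a, ∑ i, DirectSum.lof S ι N i ∘ₗ b i, ?_⟩
  refine DirectSum.linearMap_ext S fun j => LinearMap.ext fun x => ?_
  simp only [LinearMap.comp_apply, DirectSum.toModule_lof, LinearMap.sum_apply, LinearMap.id_apply]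
  rw [Finset.sum_eq_single j]
  · exact congrArg _ (LinearMap.congr_fun (hab j (Finset.mem_univ j)) x)
  · intro i _ hij
    have : b i (a j x) = 0 :=
      LinearMap.congr_fun (hab' i (Finset.mem_univ i) j (Finset.mem_univ j) hij) x
    rw [this, map_zero]
  · simp

end Summand

/-! ### Projective covers -/

section Cover

variable {S : Type u} [Ring S] [IsArtinianRing S]

/-- Take a minimal direct summand `Q` of a free module among those mapping onto `M`. If `U + ker =
Q`, projectivity gives an endomorphism `t` of `Q` over `M` with image in `U`. By Fitting the image
of a high power of `t` is again a summand mapping onto `M`, so it equals `Q`, and `U = Q`. -/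
theorem exists_projectiveCover (M : Type u) [AddCommGroup M] [Module S M] [Module.Finite S M] :
    ∃ (P : ModuleCat.{u} S) (p : P →ₗ[S] M), Module.Finite S P ∧ IsProjectiveCover p := by
  obtain ⟨n, p₀, hp₀⟩ := Module.Finite.exists_fin' S M
  obtain ⟨Q, ⟨⟨r, hrQ, hr⟩, hQ⟩, hmin⟩ := IsArtinian.set_has_minimal
    {Q : Submodule S (Fin n → S) | (∃ r : Module.End S (Fin n → S), (∀ x, r x ∈ Q) ∧
      ∀ x ∈ Q, r x = x) ∧ ∀ y, ∃ x ∈ Q, p₀ x = y}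
    ⟨⊤, ⟨1, fun _ => trivial, fun _ _ => rfl⟩, fun y => by
      obtain ⟨x, hx⟩ := hp₀ y
      exact ⟨x, trivial, hx⟩⟩
  have hproj : Module.Projective S Q := Module.Projective.of_split Q.subtype (r.codRestrict Q hrQ)
    (LinearMap.ext fun x => Subtype.ext (hr x x.2))
  have hsurj : Function.Surjective (p₀.domRestrict Q) := fun y => by
    obtain ⟨x, hx, hxy⟩ := hQ y
    exact ⟨⟨x, hx⟩, hxy⟩
  refine ⟨ModuleCat.of S Q, p₀.domRestrict Q, inferInstanceAs (Module.Finite S Q),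
    hproj, hsurj, fun U hU => ?_⟩
  change Submodule S Q at U
  have hpU : Function.Surjective ((p₀.domRestrict Q).domRestrict U) := fun y => by
    obtain ⟨x, rfl⟩ := hsurj y
    have hx : x ∈ U ⊔ LinearMap.ker (p₀.domRestrict Q) := by rw [hU]; trivial
    obtain ⟨a, ha, b, hb, rfl⟩ := Submodule.mem_sup.1 hx
    refine ⟨⟨a, ha⟩, ?_⟩
    rw [map_add, LinearMap.mem_ker.1 hb, add_zero]
    rfl
  obtain ⟨s, hs⟩ := Module.projective_lifting_property _ (p₀.domRestrict Q) hpU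
  let t : Module.End S Q := U.subtype ∘ₗ s
  have ht : ∀ x, p₀.domRestrict Q (t x) = p₀.domRestrict Q x := LinearMap.congr_fun hs
  have htn : ∀ n x, p₀.domRestrict Q ((t ^ n) x) = p₀.domRestrict Q x := fun n => by
    induction n with
    | zero => exact fun x => rfl
    | succ n ih => exact fun x => by rw [pow_succ', Module.End.mul_apply, ht, ih]
  obtain ⟨m, hm⟩ := Filter.eventually_atTop.1 t.eventually_isCompl_ker_pow_range_pow
  have h := (hm (m + 1) (Nat.le_succ m)).symm
  have hle : LinearMap.range (t ^ (m + 1)) ≤ U := by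
    rintro _ ⟨x, rfl⟩
    rw [pow_succ', Module.End.mul_apply]
    exact Subtype.property _
  have hmem : (LinearMap.range (t ^ (m + 1))).map Q.subtype ∈
      {Q : Submodule S (Fin n → S) | (∃ r : Module.End S (Fin n → S), (∀ x, r x ∈ Q) ∧
      ∀ x ∈ Q, r x = x) ∧ ∀ y, ∃ x ∈ Q, p₀ x = y} := by
    refine ⟨⟨Q.subtype ∘ₗ Submodule.subtype _ ∘ₗ Submodule.projectionOnto _ _ h ∘ₗ
      r.codRestrict Q hrQ, fun x => ?_, ?_⟩, fun y => ?_⟩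
    · exact Submodule.mem_map_of_mem (Subtype.property _)
    · rintro _ ⟨x, hx, rfl⟩
      have h1 : r.codRestrict Q hrQ (Q.subtype x) = x := Subtype.ext (hr x x.2)
      have h2 := Submodule.projectionOnto_apply_left h ⟨x, hx⟩
      simp only [LinearMap.comp_apply, h1]
      exact congrArg (fun z => Q.subtype (Submodule.subtype _ z)) h2
    · obtain ⟨x, rfl⟩ := hsurj y
      exact ⟨_, Submodule.mem_map_of_mem ⟨x, rfl⟩, htn (m + 1) x⟩
  have hnlt := hmin _ hmem
  have heq : (LinearMap.range (t ^ (m + 1))).map Q.subtype = Q := by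
    by_contra hne
    exact hnlt (lt_of_le_of_ne (Submodule.map_subtype_le _ _) hne)
  rw [eq_top_iff]
  intro x _
  have hx : (x : Fin n → S) ∈ (LinearMap.range (t ^ (m + 1))).map Q.subtype := by
    rw [heq]; exact x.2
  obtain ⟨y, hy, hyx⟩ := hx
  exact hle (Subtype.ext hyx ▸ hy)

theorem exists_minimalPresentation (M : Type u) [AddCommGroup M] [Module S M]
    [Module.Finite S M] :
    ∃ (P₁ P₀ : ModuleCat.{u} S) (f : P₁ →ₗ[S] P₀) (p : P₀ →ₗ[S] M),
      IsMinimalPresentation f p := by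
  obtain ⟨P₀, p, hP₀, hp⟩ := exists_projectiveCover (S := S) M
  obtain ⟨P₁, c, hP₁, hc⟩ := exists_projectiveCover (S := S) (LinearMap.ker p)
  have hr : LinearMap.range ((LinearMap.ker p).subtype ∘ₗ c) = LinearMap.ker p := by
    rw [LinearMap.range_comp, LinearMap.range_eq_top.2 hc.surjective, Submodule.map_top,
      Submodule.range_subtype]
  refine ⟨P₁, P₀, (LinearMap.ker p).subtype ∘ₗ c, p, hP₁, hP₀, hr, hp, hc.projective,
    LinearMap.surjective_rangeRestrict _, fun U hU => hc.superfluous U ?_⟩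
  rw [← hU, LinearMap.ker_rangeRestrict]
  congr 1
  exact (LinearMap.ker_comp_of_ker_eq_bot c (Submodule.ker_subtype _)).symm

end Cover

/-! ### Dual bases of finitely generated projective right modules -/

section DualBasis

open MulOpposite

variable {Λ : Type u} [Ring Λ]

/-- The elements `x j` and the functionals `ξ j` form a dual basis of the right module `P`. -/
def IsDualBasis {P : Type u} [AddCommGroup P] [Module Λᵐᵒᵖ P] {n : ℕ} (x : Fin n → P)
    (ξ : Fin n → P →ₗ[Λᵐᵒᵖ] Λ) : Prop :=
  ∀ y, ∑ j, op (ξ j y) • x j = y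

theorem exists_isDualBasis (Λ : Type u) [Ring Λ] (P : Type u) [AddCommGroup P] [Module Λᵐᵒᵖ P] [Module.Finite Λᵐᵒᵖ P]
    [Module.Projective Λᵐᵒᵖ P] :
    ∃ (n : ℕ) (x : Fin n → P) (ξ : Fin n → P →ₗ[Λᵐᵒᵖ] Λ), IsDualBasis x ξ := by
  obtain ⟨n, f, hf⟩ := Module.Finite.exists_fin' Λᵐᵒᵖ P
  obtain ⟨s, hs⟩ := Module.projective_lifting_property f LinearMap.id hf
  let o : Λᵐᵒᵖ →ₗ[Λᵐᵒᵖ] Λ :=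
    { toFun := unop, map_add' := fun _ _ => rfl, map_smul' := fun _ _ => rfl }
  refine ⟨n, fun j => f (Pi.single j 1), fun j => o ∘ₗ LinearMap.proj j ∘ₗ s, fun y => ?_⟩
  conv_rhs => rw [← LinearMap.id_apply (R := Λᵐᵒᵖ) y, ← hs, LinearMap.comp_apply,
    ← Finset.univ_sum_single (s y), map_sum]
  refine Finset.sum_congr rfl fun j _ => ?_
  rw [← map_smul, ← Pi.single_smul, smul_eq_mul, mul_one]
  rfl

variable {P : Type u} [AddCommGroup P] [Module Λᵐᵒᵖ P] {n : ℕ} {x : Fin n → P}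
  {ξ : Fin n → P →ₗ[Λᵐᵒᵖ] Λ}

theorem IsDualBasis.sum_smul (h : IsDualBasis x ξ) (ζ : P →ₗ[Λᵐᵒᵖ] Λ) :
    ∑ j, ζ (x j) • ξ j = ζ := by
  ext y
  conv_rhs => rw [← h y, map_sum]
  simp [LinearMap.sum_apply]

theorem IsDualBasis.map_eq (h : IsDualBasis x ξ) {M : Type u} [AddCommGroup M] [Module Λ M]
    (θ : (P →ₗ[Λᵐᵒᵖ] Λ) →ₗ[Λ] M) (ζ : P →ₗ[Λᵐᵒᵖ] Λ) : θ ζ = ∑ j, ζ (x j) • θ (ξ j) := by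
  conv_lhs => rw [← h.sum_smul ζ, map_sum]
  simp

theorem IsDualBasis.finite_dual (h : IsDualBasis x ξ) : Module.Finite Λ (P →ₗ[Λᵐᵒᵖ] Λ) := by
  classical
  refine ⟨⟨Finset.univ.image ξ, eq_top_iff.2 fun ζ _ => ?_⟩⟩
  rw [← h.sum_smul ζ]
  exact Submodule.sum_mem _ fun j _ => Submodule.smul_mem _ _ (Submodule.subset_span (by simp))

theorem IsDualBasis.projective_dual (h : IsDualBasis x ξ) :
    Module.Projective Λ (P →ₗ[Λᵐᵒᵖ] Λ) := by
  let i : (P →ₗ[Λᵐᵒᵖ] Λ) →ₗ[Λ] (Fin n → Λ) :=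
    { toFun := fun ζ j => ζ (x j), map_add' := fun _ _ => rfl, map_smul' := fun _ _ => rfl }
  let s : (Fin n → Λ) →ₗ[Λ] (P →ₗ[Λᵐᵒᵖ] Λ) :=
    { toFun := fun c => ∑ j, c j • ξ j
      map_add' := fun a b => by simp [add_smul, Finset.sum_add_distrib]
      map_smul' := fun a b => by simp [mul_smul, Finset.smul_sum] }
  exact Module.Projective.of_split i s (LinearMap.ext h.sum_smul)

variable {Q : Type u} [AddCommGroup Q] [Module Λᵐᵒᵖ Q]

theorem IsDualBasis.ext_dual (h : IsDualBasis x ξ) {a b : Q →ₗ[Λᵐᵒᵖ] P}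
    (hab : ∀ ζ : P →ₗ[Λᵐᵒᵖ] Λ, ζ ∘ₗ a = ζ ∘ₗ b) : a = b := by
  ext y
  rw [← h (a y), ← h (b y)]
  refine Finset.sum_congr rfl fun j _ => ?_
  exact congrArg (fun c => op c • x j) (LinearMap.congr_fun (hab (ξ j)) y)

/-- Every linear map between the duals of finitely generated projective modules is a transpose. -/
theorem IsDualBasis.exists_eq_comp (h : IsDualBasis x ξ)
    (θ : (P →ₗ[Λᵐᵒᵖ] Λ) →ₗ[Λ] (Q →ₗ[Λᵐᵒᵖ] Λ)) :
    ∃ a : Q →ₗ[Λᵐᵒᵖ] P, ∀ ζ, θ ζ = ζ ∘ₗ a := by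
  refine ⟨∑ j, LinearMap.smulRight
    (⟨⟨fun y => op (θ (ξ j) y), fun y z => by simp⟩, fun c y => by simp⟩ : Q →ₗ[Λᵐᵒᵖ] Λᵐᵒᵖ) (x j),
    fun ζ => ?_⟩
  ext y
  rw [h.map_eq θ ζ]
  simp [LinearMap.sum_apply]

end DualBasis

/-! ### The pairing of a module with its dual -/

section Pairing

open MulOpposite

variable (R Λ : Type u) [CommRing R] [Ring Λ] [Algebra R Λ]

/-- The evaluation pairing `D(L) × L → J`. -/
def dualPairing (L : Type u) [AddCommGroup L] [Module Λ L] :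
    Dual R Λ L →+ L →+ dualizingModule R where
  toFun u :=
    { toFun := fun l => (show RestrictScalars R Λ L →ₗ[R] dualizingModule R from u) l
      map_zero' := (show RestrictScalars R Λ L →ₗ[R] dualizingModule R from u).map_zero
      map_add' := (show RestrictScalars R Λ L →ₗ[R] dualizingModule R from u).map_add }
  map_zero' := rfl
  map_add' _ _ := rfl

variable {R Λ} {L : Type u} [AddCommGroup L] [Module Λ L]

theorem dualPairing_op_smul (a : Λ) (u : Dual R Λ L) (l : L) :
    dualPairing R Λ L (op a • u) l = dualPairing R Λ L u (a • l) := rfl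

theorem dualPairing_algebraMap_smul (r : R) (u : Dual R Λ L) (l : L) :
    dualPairing R Λ L u (algebraMap R Λ r • l) = r • dualPairing R Λ L u l :=
  (show RestrictScalars R Λ L →ₗ[R] dualizingModule R from u).map_smul r l

theorem dualPairing_ext {u v : Dual R Λ L}
    (h : ∀ l, dualPairing R Λ L u l = dualPairing R Λ L v l) : u = v :=
  LinearMap.ext (f := (show RestrictScalars R Λ L →ₗ[R] dualizingModule R from u)) h

/-- The additive group `D(L)` consists of the linear maps `L → J` for any compatible `R`-module
structure on `L`. -/
def dualEquiv (R Λ L : Type u) [CommRing R] [Ring Λ] [Algebra R Λ] [AddCommGroup L] [Module Λ L]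
    [Module R L] [IsScalarTower R Λ L] :
    (L →ₗ[R] dualizingModule R) ≃+ Dual R Λ L where
  toFun u := show RestrictScalars R Λ L →ₗ[R] dualizingModule R from
    { toFun := u
      map_add' := u.map_add
      map_smul' := fun r l => Eq.trans (congrArg u (algebraMap_smul (M := L) Λ r l)) (u.map_smul r l) }
  invFun u :=
    { toFun := dualPairing R Λ L u
      map_add' := (dualPairing R Λ L u).map_add
      map_smul' := fun r l => by
        rw [← algebraMap_smul Λ r l, dualPairing_algebraMap_smul, RingHom.id_apply] }
  left_inv _ := rfl
  right_inv _ := rfl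
  map_add' _ _ := rfl

theorem dualEquiv_smul [Module R L] [IsScalarTower R Λ L] (r : R)
    (u : L →ₗ[R] dualizingModule R) :
    dualEquiv R Λ L (r • u) = op (algebraMap R Λ r) • dualEquiv R Λ L u :=
  dualPairing_ext fun l => by
    rw [dualPairing_op_smul, dualPairing_algebraMap_smul]
    rfl

/-- Lets proofs put the `R`-action through `Λ` on a module locally, so that no statement has to
carry it. -/
theorem isScalarTower_compHom :
    letI : Module R L := Module.compHom L (algebraMap R Λ)
    IsScalarTower R Λ L :=
  letI : Module R L := Module.compHom L (algebraMap R Λ)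
  ⟨fun r a l => by rw [Algebra.smul_def, mul_smul]; rfl⟩

variable [IsArtinianRing R]

theorem dualPairing_separating {l l' : L}
    (h : ∀ u, dualPairing R Λ L u l = dualPairing R Λ L u l') : l = l' := by
  let _ : Module R L := Module.compHom L (algebraMap R Λ)
  have : IsScalarTower R Λ L := isScalarTower_compHom
  by_contra hne
  obtain ⟨μ, hμ⟩ := exists_functional_ne_zero R (sub_ne_zero.2 hne)
  apply hμ
  rw [map_sub, sub_eq_zero]
  exact h (dualEquiv R Λ L μ)

/-- Reflexivity of finitely generated `R`-modules; `hω` expresses `R`-linearity through the right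
action of `Λ` on `D(L)`. -/
theorem exists_dualPairing_eq [Module.Finite R Λ] [Module.Finite Λ L]
    (ω : Dual R Λ L →+ dualizingModule R)
    (hω : ∀ (r : R) (u : Dual R Λ L), ω (op (algebraMap R Λ r) • u) = r • ω u) :
    ∃ l, ∀ u, ω u = dualPairing R Λ L u l := by
  let _ : Module R L := Module.compHom L (algebraMap R Λ)
  have : IsScalarTower R Λ L := isScalarTower_compHom
  have : Module.Finite R L := Module.Finite.trans Λ L
  obtain ⟨l, hl⟩ := exists_eval_eq R (V := L)
    { toFun := fun u => ω (dualEquiv R Λ L u)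
      map_add' := fun u v => by rw [map_add, map_add]
      map_smul' := fun r u => by rw [dualEquiv_smul, hω, RingHom.id_apply] }
  refine ⟨l, fun u => ?_⟩
  obtain ⟨u, rfl⟩ := (dualEquiv R Λ L).surjective u
  exact hl u

theorem finite_dual [Module.Finite R Λ] [Module.Finite Λ L] :
    Module.Finite Λᵐᵒᵖ (Dual R Λ L) := by
  let _ : Module R L := Module.compHom L (algebraMap R Λ)
  have : IsScalarTower R Λ L := isScalarTower_compHom
  have : Module.Finite R L := Module.Finite.trans Λ L
  have := (bidual_surjective_and_isNoetherian R L).2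
  obtain ⟨s, hs⟩ := this.noetherian ⊤
  classical
  refine ⟨⟨s.image (dualEquiv R Λ L), Submodule.eq_top_iff'.2 fun u => ?_⟩⟩
  obtain ⟨u, rfl⟩ := (dualEquiv R Λ L).surjective u
  have hu : u ∈ Submodule.span R (s : Set (L →ₗ[R] dualizingModule R)) := by rw [hs]; trivial
  induction hu using Submodule.span_induction with
  | mem u hu => exact Submodule.subset_span (by simpa using hu)
  | zero => rw [map_zero]; exact Submodule.zero_mem _
  | add u v _ _ hu hv => rw [map_add]; exact Submodule.add_mem _ hu hv
  | smul r u _ hu => rw [dualEquiv_smul]; exact Submodule.smul_mem _ _ hu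

/-- Every endomorphism of `D(L)` is dual to an endomorphism of `L`. -/
theorem exists_end_of_end_dual [Module.Finite R Λ] [Module.Finite Λ L]
    (d : Module.End Λᵐᵒᵖ (Dual R Λ L)) :
    ∃ ε : Module.End Λ L, ∀ u l, dualPairing R Λ L (d u) l = dualPairing R Λ L u (ε l) := by
  have h : ∀ l : L, ∃ l' : L, ∀ u, dualPairing R Λ L (d u) l = dualPairing R Λ L u l' :=
    fun l => exists_dualPairing_eq
      ((AddMonoidHom.eval l).comp ((dualPairing R Λ L).comp d.toAddMonoidHom)) fun r u => by
        change dualPairing R Λ L (d (op _ • u)) l = r • dualPairing R Λ L (d u) l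
        rw [map_smul, dualPairing_op_smul, dualPairing_algebraMap_smul]
  choose ε hε using h
  refine ⟨⟨⟨ε, fun a b => dualPairing_separating (R := R) (Λ := Λ) fun u => ?_⟩,
    fun a b => dualPairing_separating (R := R) (Λ := Λ) fun u => ?_⟩, fun u l => hε l u⟩
  · rw [map_add, ← hε, ← hε, ← hε, map_add]
  · rw [RingHom.id_apply, ← dualPairing_op_smul, ← hε, ← hε, map_smul d, dualPairing_op_smul]

end Pairing

/-! ### The transpose of a minimal presentation -/

section Transpose

open MulOpposite

variable {R Λ : Type u} [CommRing R] [Ring Λ] [Algebra R Λ]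

theorem isArtinianRing_op (R Λ : Type u) [CommRing R] [Ring Λ] [Algebra R Λ] [IsArtinianRing R]
    [Module.Finite R Λ] : IsArtinianRing Λᵐᵒᵖ :=
  have : Module.Finite R Λᵐᵒᵖ := Module.Finite.equiv (opLinearEquiv R (M := Λ))
  IsArtinianRing.of_finite R Λᵐᵒᵖ

theorem exists_isTrD (R : Type u) [CommRing R] [Algebra R Λ] [IsArtinianRing R]
    [Module.Finite R Λ] (L : Type u) [AddCommGroup L] [Module Λ L] [Module.Finite Λ L] :
    ∃ N : ModuleCat.{u} Λ, Module.Finite Λ N ∧ IsTrD R Λ L N := by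
  have := isArtinianRing_op R Λ
  have := finite_dual (R := R) (Λ := Λ) (L := L)
  obtain ⟨P₁, P₀, f, p, h⟩ := exists_minimalPresentation (S := Λᵐᵒᵖ) (Dual R Λ L)
  have := h.finite₁
  have := h.cover₁.projective
  obtain ⟨n, y, η, hη⟩ := exists_isDualBasis Λ P₁
  have := hη.finite_dual
  exact ⟨ModuleCat.of Λ (TransposeOf f), inferInstanceAs (Module.Finite Λ (TransposeOf f)),
    P₁, P₀, f, p, h, ⟨LinearEquiv.refl _ _⟩⟩

variable [IsArtinianRing R] [Module.Finite R Λ] {L : Type u} [AddCommGroup L] [Module Λ L] {P₁ P₀ : Type u} [AddCommGroup P₁] [Module Λᵐᵒᵖ P₁]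
  [AddCommGroup P₀] [Module Λᵐᵒᵖ P₀] {f : P₁ →ₗ[Λᵐᵒᵖ] P₀} {p : P₀ →ₗ[Λᵐᵒᵖ] Dual R Λ L}

/-- Superfluity of the kernels passes surjectivity from `d` to `a₀` and then to `a₁`; a surjective
endomorphism of a noetherian module is bijective. -/
theorem IsMinimalPresentation.bijective_of_bijective (h : IsMinimalPresentation f p)
    {a₁ : Module.End Λᵐᵒᵖ P₁} {a₀ : Module.End Λᵐᵒᵖ P₀} {d : Module.End Λᵐᵒᵖ (Dual R Λ L)}
    (hf : f ∘ₗ a₁ = a₀ ∘ₗ f) (hp : p ∘ₗ a₀ = d ∘ₗ p) (hd : Function.Bijective d) :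
    Function.Bijective a₁ := by
  have := isArtinianRing_op R Λ
  have := h.finite₁
  have := h.finite₀
  have hf' : ∀ x, f (a₁ x) = a₀ (f x) := LinearMap.congr_fun hf
  have hp' : ∀ x, p (a₀ x) = d (p x) := LinearMap.congr_fun hp
  have h₀ : Function.Surjective a₀ := by
    rw [← LinearMap.range_eq_top]
    refine h.cover₀.superfluous _ (eq_top_iff.2 fun x _ => ?_)
    obtain ⟨y, hy⟩ := hd.2 (p x)
    obtain ⟨z, rfl⟩ := h.cover₀.surjective y
    refine Submodule.mem_sup.2 ⟨a₀ z, ⟨z, rfl⟩, x - a₀ z, ?_, by abel⟩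
    rw [LinearMap.mem_ker, map_sub, hp', hy, sub_self]
  refine IsNoetherian.bijective_of_surjective_endomorphism a₁ (LinearMap.range_eq_top.1 ?_)
  refine h.cover₁.superfluous _ (eq_top_iff.2 fun x _ => ?_)
  obtain ⟨z, hz⟩ := h₀ (f x)
  have hzk : z ∈ LinearMap.ker p := by
    rw [LinearMap.mem_ker]
    apply hd.1
    rw [← hp', hz, map_zero]
    have : f x ∈ LinearMap.ker p := h.exact ▸ LinearMap.mem_range_self f x
    exact this
  rw [← h.exact] at hzk
  obtain ⟨y, rfl⟩ := hzk
  refine Submodule.mem_sup.2 ⟨a₁ y, ⟨y, rfl⟩, x - a₁ y, ?_, by abel⟩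
  rw [LinearMap.ker_rangeRestrict, LinearMap.mem_ker, map_sub, hf', hz, sub_self]

/-- If `d ^ n = 0`, then `a₀ ^ n` lands in the kernel of `p`, hence lifts to `t` with `f t = a₀ ^
n`. The difference `a₁ ^ n - t f` maps into the superfluous kernel of `f`. On the transpose the term
`t f` will induce zero. -/
theorem IsMinimalPresentation.exists_isNilpotent (h : IsMinimalPresentation f p)
    {a₁ : Module.End Λᵐᵒᵖ P₁} {a₀ : Module.End Λᵐᵒᵖ P₀} {d : Module.End Λᵐᵒᵖ (Dual R Λ L)}
    (hf : f ∘ₗ a₁ = a₀ ∘ₗ f) (hp : p ∘ₗ a₀ = d ∘ₗ p) (hd : IsNilpotent d) :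
    ∃ (n : ℕ) (t : P₀ →ₗ[Λᵐᵒᵖ] P₁) (k : Module.End Λᵐᵒᵖ P₁), a₁ ^ n = t ∘ₗ f + k ∧
      IsNilpotent k := by
  have := isArtinianRing_op R Λ
  have := h.finite₁
  have := h.cover₀.projective
  obtain ⟨n, hn⟩ := hd
  have hfn : ∀ x, f ((a₁ ^ n) x) = (a₀ ^ n) (f x) := fun x => by
    have : (a₀ ^ n) ∘ₗ f = f ∘ₗ (a₁ ^ n) := Module.End.commute_pow_left_of_commute hf.symm n
    exact (LinearMap.congr_fun this x).symm
  have hpn : ∀ x, p ((a₀ ^ n) x) = 0 := fun x => by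
    have : (d ^ n) ∘ₗ p = p ∘ₗ (a₀ ^ n) := Module.End.commute_pow_left_of_commute hp.symm n
    rw [hn] at this
    exact (LinearMap.congr_fun this x).symm
  obtain ⟨t, ht⟩ := exists_comp_eq_of_range_le_range (f := f) (g := a₀ ^ n) (by
    rw [h.exact]
    rintro _ ⟨x, rfl⟩
    exact hpn x)
  refine ⟨n, t, a₁ ^ n - t ∘ₗ f, by abel, ?_⟩
  refine isNilpotent_of_range_le_superfluous _ _ h.cover₁.superfluous ?_
  rintro _ ⟨x, rfl⟩
  rw [LinearMap.ker_rangeRestrict, LinearMap.mem_ker, LinearMap.sub_apply, map_sub, hfn, ← ht]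
  exact sub_self _

/-- Endomorphisms of the transpose of `D(L)` are invertible or nilpotent if `L` is
indecomposable. -/
theorem IsMinimalPresentation.isUnit_or_isNilpotent_end_transposeOf [Module.Finite Λ L]
    (h : IsMinimalPresentation f p) (hL : Indecomposable Λ L) (e : Module.End Λ (TransposeOf f)) :
    IsUnit e ∨ IsNilpotent e := by
  have : IsArtinianRing Λ := IsArtinianRing.of_finite R Λ
  have := isArtinianRing_op R Λ
  have := h.finite₁
  have := h.finite₀
  have := h.cover₀.projective
  have := h.cover₁.projective
  obtain ⟨n₁, y, η, hη⟩ := exists_isDualBasis Λ P₁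
  obtain ⟨n₀, x, ξ, hξ⟩ := exists_isDualBasis Λ P₀
  have := hη.projective_dual
  have := hξ.projective_dual
  have := hη.finite_dual
  let π := (LinearMap.range (LinearMap.lcomp Λ Λ f)).mkQ
  have hπ : Function.Surjective π := Submodule.mkQ_surjective _
  -- Transport `e` back to `L`: lift it to the projective presentation of the transpose, dualise to
  -- an endomorphism of `P₁ → P₀`, pass to the cokernel `D(L)`, and dualise again to `ε`. Fitting
  -- applies to `ε`.
  obtain ⟨b₁, hb₁⟩ := Module.projective_lifting_property π (e ∘ₗ π) hπ
  have hb₁' : ∀ ζ, π (b₁ ζ) = e (π ζ) := LinearMap.congr_fun hb₁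
  obtain ⟨b₀, hb₀⟩ := exists_comp_eq_of_range_le_range (f := LinearMap.lcomp Λ Λ f)
    (g := b₁ ∘ₗ LinearMap.lcomp Λ Λ f) (by
      rintro _ ⟨ζ, rfl⟩
      rw [← Submodule.Quotient.mk_eq_zero]
      refine (hb₁' _).trans ?_
      have : π (LinearMap.lcomp Λ Λ f ζ) = 0 := (Submodule.Quotient.mk_eq_zero _).2 ⟨ζ, rfl⟩
      rw [this, map_zero])
  obtain ⟨a₁, ha₁⟩ := hη.exists_eq_comp b₁
  obtain ⟨a₀, ha₀⟩ := hξ.exists_eq_comp b₀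
  have hf : f ∘ₗ a₁ = a₀ ∘ₗ f := hξ.ext_dual fun ζ => by
    have h1 : b₀ ζ ∘ₗ f = b₁ (ζ ∘ₗ f) := LinearMap.congr_fun hb₀ ζ
    rw [ha₀, ha₁] at h1
    exact h1.symm
  obtain ⟨d, hd⟩ := exists_comp_eq_of_ker_le_ker h.cover₀.surjective (u := p ∘ₗ a₀) (by
    rw [← h.exact]
    rintro _ ⟨z, rfl⟩
    have h1 : f (a₁ z) ∈ LinearMap.ker p := h.exact ▸ LinearMap.mem_range_self f _
    have h2 : f (a₁ z) = a₀ (f z) := LinearMap.congr_fun hf z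
    rw [h2] at h1
    exact h1)
  obtain ⟨ε, hε⟩ := exists_end_of_end_dual d
  rcases hL.isUnit_or_isNilpotent ε with hu | ⟨n, hn⟩
  · left
    have hdinj : Function.Injective d := by
      rw [← LinearMap.ker_eq_bot, eq_bot_iff]
      intro u hu'
      refine dualPairing_ext fun l => ?_
      obtain ⟨l, rfl⟩ := ((Module.End.isUnit_iff _).1 hu).2 l
      rw [← hε, LinearMap.mem_ker.1 hu', map_zero]
      rfl
    have : Module.Finite Λᵐᵒᵖ (Dual R Λ L) := finite_dual
    have ha := h.bijective_of_bijective hf hd.symm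
      (IsArtinian.bijective_of_injective_endomorphism d hdinj)
    rw [Module.End.isUnit_iff]
    refine IsNoetherian.bijective_of_surjective_endomorphism e fun z => ?_
    obtain ⟨ζ, rfl⟩ := hπ z
    refine ⟨π (ζ ∘ₗ (LinearEquiv.ofBijective a₁ ha).symm.toLinearMap), ?_⟩
    rw [← hb₁', ha₁]
    congr 1
    ext z
    exact congrArg ζ ((LinearEquiv.ofBijective a₁ ha).symm_apply_apply z)
  · right
    have hdn : IsNilpotent d := by
      refine ⟨n, LinearMap.ext fun u => dualPairing_ext fun l => ?_⟩
      have : ∀ (m : ℕ) (u : Dual R Λ L) (l : L),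
          dualPairing R Λ L ((d ^ m) u) l = dualPairing R Λ L u ((ε ^ m) l) := by
        intro m
        induction m with
        | zero => exact fun u l => rfl
        | succ m ih =>
          intro u l
          rw [pow_succ, Module.End.mul_apply, ih, hε, pow_succ', Module.End.mul_apply]
      rw [this, hn, LinearMap.zero_apply, map_zero, LinearMap.zero_apply, map_zero]
      rfl
    obtain ⟨m, t, k, hk, j, hj⟩ := h.exists_isNilpotent hf hd.symm hdn
    have hem : ∀ (m : ℕ) ζ, (e ^ m) (π ζ) = π (ζ ∘ₗ (a₁ ^ m)) := by
      intro m
      induction m with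
      | zero => exact fun ζ => rfl
      | succ m ih =>
        intro ζ
        rw [pow_succ', Module.End.mul_apply, ih, ← hb₁', ha₁, pow_succ]
        rfl
    have hek : ∀ ζ, (e ^ m) (π ζ) = π (ζ ∘ₗ k) := fun ζ => by
      rw [hem, hk, LinearMap.comp_add, map_add, ← LinearMap.comp_assoc]
      have : π ((ζ ∘ₗ t) ∘ₗ f) = 0 := (Submodule.Quotient.mk_eq_zero _).2 ⟨ζ ∘ₗ t, rfl⟩
      rw [this, zero_add]
    have hekj : ∀ (j : ℕ) ζ, ((e ^ m) ^ j) (π ζ) = π (ζ ∘ₗ (k ^ j)) := by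
      intro j
      induction j with
      | zero => exact fun ζ => rfl
      | succ j ih =>
        intro ζ
        rw [pow_succ', Module.End.mul_apply, ih, hek, pow_succ]
        rfl
    refine ⟨m * j, LinearMap.ext fun z => ?_⟩
    obtain ⟨ζ, rfl⟩ := hπ z
    rw [pow_mul, hekj, hj, LinearMap.comp_zero, map_zero, LinearMap.zero_apply]

end Transpose

/-! ### The trace pairing -/

section Trace

open MulOpposite

variable {R Λ : Type u} [CommRing R] [Ring Λ] [Algebra R Λ] {L : Type u} [AddCommGroup L]
  [Module Λ L] {P₁ P₀ : Type u} [AddCommGroup P₁] [Module Λᵐᵒᵖ P₁]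
  [AddCommGroup P₀] [Module Λᵐᵒᵖ P₀] {f : P₁ →ₗ[Λᵐᵒᵖ] P₀} {p : P₀ →ₗ[Λᵐᵒᵖ] Dual R Λ L}
  {n₀ : ℕ} {x : Fin n₀ → P₀} {ξ : Fin n₀ → P₀ →ₗ[Λᵐᵒᵖ] Λ}

/-- Evaluation `Hom(P₀*, L) = P₀ ⊗ L → D(L) ⊗ L → J`, in terms of a dual basis of `P₀`. -/
def tracePairing (p : P₀ →ₗ[Λᵐᵒᵖ] Dual R Λ L) (x : Fin n₀ → P₀) (ξ : Fin n₀ → P₀ →ₗ[Λᵐᵒᵖ] Λ) :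
    ((P₀ →ₗ[Λᵐᵒᵖ] Λ) →ₗ[Λ] L) →+ dualizingModule R where
  toFun θ := ∑ j, dualPairing R Λ L (p (x j)) (θ (ξ j))
  map_zero' := by simp
  map_add' a b := by simp [Finset.sum_add_distrib]

theorem tracePairing_apply (θ : (P₀ →ₗ[Λᵐᵒᵖ] Λ) →ₗ[Λ] L) :
    tracePairing p x ξ θ = ∑ j, dualPairing R Λ L (p (x j)) (θ (ξ j)) := rfl

/-- Under `Hom(P₀*, L) = P₀ ⊗ L`, such composites are the image of `P₁ ⊗ L`, which dies in `D(L) ⊗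
L`. -/
theorem tracePairing_comp_lcomp (hx : IsDualBasis x ξ) {n₁ : ℕ} {y : Fin n₁ → P₁}
    {η : Fin n₁ → P₁ →ₗ[Λᵐᵒᵖ] Λ} (hy : IsDualBasis y η) (hpf : ∀ z, p (f z) = 0)
    (θ : (P₁ →ₗ[Λᵐᵒᵖ] Λ) →ₗ[Λ] L) : tracePairing p x ξ (θ ∘ₗ LinearMap.lcomp Λ Λ f) = 0 := by
  have h1 : ∀ j, dualPairing R Λ L (p (x j)) ((θ ∘ₗ LinearMap.lcomp Λ Λ f) (ξ j)) =
      ∑ k, dualPairing R Λ L (p (op (ξ j (f (y k))) • x j)) (θ (η k)) := fun j => by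
    rw [LinearMap.comp_apply, hy.map_eq θ, map_sum]
    refine Finset.sum_congr rfl fun k _ => ?_
    rw [map_smul p, dualPairing_op_smul]
    rfl
  rw [tracePairing_apply, Finset.sum_congr rfl fun j _ => h1 j, Finset.sum_comm]
  refine Finset.sum_eq_zero fun k _ => ?_
  have h2 := hpf (y k)
  rw [← hx (f (y k)), map_sum] at h2
  rw [← AddMonoidHom.finsetSum_apply, ← map_sum, h2, map_zero, AddMonoidHom.zero_apply]

/-- The linear map `P* → M`, `ξ ↦ ξ(z) m`. -/
def evalSMul {M : Type u} [AddCommGroup M] [Module Λ M] (z : P₀) (m : M) :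
    (P₀ →ₗ[Λᵐᵒᵖ] Λ) →ₗ[Λ] M where
  toFun ζ := ζ z • m
  map_add' a b := by simp [add_smul]
  map_smul' a b := by simp [mul_smul]

theorem tracePairing_evalSMul (hx : IsDualBasis x ξ) (z : P₀) (l : L) :
    tracePairing p x ξ (evalSMul z l) = dualPairing R Λ L (p z) l := by
  rw [tracePairing_apply]
  conv_rhs => rw [← hx z, map_sum, map_sum, AddMonoidHom.finsetSum_apply]
  refine Finset.sum_congr rfl fun j _ => ?_
  rw [map_smul, dualPairing_op_smul]
  rfl

variable [IsArtinianRing R] [Module.Finite R Λ]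

/-- The cokernel of `Hom(P₁*, M) → Hom(P₀*, M)` is `D(L) ⊗ M`, whose `J`-dual is `Hom(M, DD(L)) =
Hom(M, L)`. As `J` cogenerates, a class in the cokernel is zero once every `h : M → L` kills it. -/
theorem exists_factor_of_tracePairing_eq_zero [Module.Finite Λ L] (hx : IsDualBasis x ξ)
    (hp : Function.Surjective p) (hpf : LinearMap.range f = LinearMap.ker p)
    {M : Type u} [AddCommGroup M] [Module Λ M] (θ : (P₀ →ₗ[Λᵐᵒᵖ] Λ) →ₗ[Λ] M)
    (hθ : ∀ h : M →ₗ[Λ] L, tracePairing p x ξ (h ∘ₗ θ) = 0) :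
    ∃ σ : (P₁ →ₗ[Λᵐᵒᵖ] Λ) →ₗ[Λ] M, σ ∘ₗ LinearMap.lcomp Λ Λ f = θ := by
  let _ : Module R M := Module.compHom M (algebraMap R Λ)
  have : IsScalarTower R Λ M := isScalarTower_compHom
  have : SMulCommClass Λ R M := IsScalarTower.to_smulCommClass'
  let T : ((P₁ →ₗ[Λᵐᵒᵖ] Λ) →ₗ[Λ] M) →ₗ[R] ((P₀ →ₗ[Λᵐᵒᵖ] Λ) →ₗ[Λ] M) :=
    LinearMap.lcomp R M (LinearMap.lcomp Λ Λ f)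
  by_contra hne
  have hne' : (LinearMap.range T).mkQ θ ≠ 0 := fun h0 =>
    hne ((Submodule.Quotient.mk_eq_zero _).1 h0)
  obtain ⟨μ₀, hμ₀⟩ := exists_functional_ne_zero R hne'
  let μ : ((P₀ →ₗ[Λᵐᵒᵖ] Λ) →ₗ[Λ] M) →ₗ[R] dualizingModule R := μ₀ ∘ₗ (LinearMap.range T).mkQ
  have hμT : ∀ σ, μ (T σ) = 0 := fun σ => by
    have : (LinearMap.range T).mkQ (T σ) = 0 := (Submodule.Quotient.mk_eq_zero _).2 ⟨σ, rfl⟩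
    rw [LinearMap.comp_apply, this, map_zero]
  have hadd : ∀ (z w : P₀) (m : M), μ (evalSMul (z + w) m) = μ (evalSMul z m) + μ (evalSMul w m) :=
    fun z w m => by
      rw [← map_add]
      congr 1
      ext ζ
      simp [evalSMul, add_smul]
  have hop : ∀ (a : Λ) (z : P₀) (m : M), μ (evalSMul (op a • z) m) = μ (evalSMul z (a • m)) :=
    fun a z m => by
      congr 1
      ext ζ
      simp [evalSMul, mul_smul]
  have halg : ∀ (r : R) (z : P₀) (m : M),
      μ (evalSMul z (algebraMap R Λ r • m)) = r • μ (evalSMul z m) := fun r z m => by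
    rw [← map_smul]
    congr 1
    ext ζ
    change ζ z • algebraMap R Λ r • m = r • ζ z • m
    rw [algebraMap_smul, smul_comm]
  have hker : ∀ (z w : P₀) (m : M), p z = p w → μ (evalSMul z m) = μ (evalSMul w m) := by
    intro z w m hzw
    have hmem : z - w ∈ LinearMap.range f := by
      rw [hpf, LinearMap.mem_ker, map_sub, hzw, sub_self]
    obtain ⟨v, hv⟩ := hmem
    have h0 : μ (evalSMul (f v) m) = 0 := hμT (evalSMul v m)
    rw [← sub_add_cancel z w, ← hv, hadd, h0, zero_add]
  -- A set-theoretic section suffices: by `hker` the value of `μ` on `z ⊗ m` depends only on `p z`,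
  -- so each `m` defines an element of `DD(L)`, that is, of `L`.
  choose s hs using hp
  have hl : ∀ m : M, ∃ l : L, ∀ z, μ (evalSMul z m) = dualPairing R Λ L (p z) l := fun m => by
    obtain ⟨l, hl⟩ := exists_dualPairing_eq
      (AddMonoidHom.mk' (fun u => μ (evalSMul (s u) m)) fun u v => by
        rw [← hadd]
        exact hker _ _ _ (by rw [map_add, hs, hs, hs]))
      (fun r u => by
        change μ (evalSMul (s _) m) = r • μ (evalSMul (s u) m)
        rw [← halg, ← hop]
        exact hker _ _ _ (by rw [map_smul, hs, hs]))
    refine ⟨l, fun z => ?_⟩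
    rw [← hl (p z)]
    exact hker _ _ _ (hs _).symm
  choose h hh using hl
  have hmap : ∀ z m, dualPairing R Λ L (p z) (h m) = μ (evalSMul z m) := fun z m => (hh m z).symm
  have hsep : ∀ l l' : L, (∀ z, dualPairing R Λ L (p z) l = dualPairing R Λ L (p z) l') →
      l = l' := fun l l' hll => dualPairing_separating (R := R) (Λ := Λ) fun u => by
    rw [← hs u]; exact hll _
  let h' : M →ₗ[Λ] L :=
    { toFun := h
      map_add' := fun a b => hsep _ _ fun z => by
        rw [map_add, hmap, hmap, hmap, ← map_add]
        congr 1
        ext ζ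
        simp [evalSMul]
      map_smul' := fun a b => hsep _ _ fun z => by
        rw [hmap, RingHom.id_apply, ← dualPairing_op_smul, ← map_smul p, hmap, hop] }
  apply hμ₀
  have hθ' : θ = ∑ j, evalSMul (x j) (θ (ξ j)) := by
    ext ζ
    rw [hx.map_eq θ ζ, LinearMap.sum_apply]
    rfl
  change μ θ = 0
  rw [hθ', map_sum, ← hθ h', tracePairing_apply]
  exact Finset.sum_congr rfl fun j _ => hh _ _

/-- The pairing embeds `Hom(M, L)` into the `J`-dual of `Hom(P₀*, M)`. Injectivity of `J` extends
`lam` to that dual, and reflexivity makes the extension evaluation at some `θ`. -/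
theorem exists_tracePairing_eq (hx : IsDualBasis x ξ) (hp : Function.Surjective p)
    {M : Type u} [AddCommGroup M] [Module Λ M] [Module.Finite Λ M]
    [Module R L] [IsScalarTower R Λ L] [SMulCommClass Λ R L]
    (lam : (M →ₗ[Λ] L) →ₗ[R] dualizingModule R) :
    ∃ θ : (P₀ →ₗ[Λᵐᵒᵖ] Λ) →ₗ[Λ] M, ∀ h, tracePairing p x ξ (h ∘ₗ θ) = lam h := by
  let _ : Module R M := Module.compHom M (algebraMap R Λ)
  have : IsScalarTower R Λ M := isScalarTower_compHom
  have : SMulCommClass Λ R M := IsScalarTower.to_smulCommClass'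
  have : Module.Finite R M := Module.Finite.trans Λ M
  have : Module.Finite R ((P₀ →ₗ[Λᵐᵒᵖ] Λ) →ₗ[Λ] M) := by
    let F : ((P₀ →ₗ[Λᵐᵒᵖ] Λ) →ₗ[Λ] M) →ₗ[R] (Fin n₀ → M) :=
      { toFun := fun θ j => θ (ξ j), map_add' := fun _ _ => rfl, map_smul' := fun _ _ => rfl }
    refine Module.Finite.of_injective F fun θ θ' h => ?_
    ext ζ
    rw [hx.map_eq θ, hx.map_eq θ']
    exact Finset.sum_congr rfl fun j _ => congrArg _ (congrFun h j)
  have halg : ∀ (r : R) (θ : (P₀ →ₗ[Λᵐᵒᵖ] Λ) →ₗ[Λ] L),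
      tracePairing p x ξ (r • θ) = r • tracePairing p x ξ θ := fun r θ => by
    rw [tracePairing_apply, tracePairing_apply, Finset.smul_sum]
    refine Finset.sum_congr rfl fun j _ => ?_
    rw [LinearMap.smul_apply, ← algebraMap_smul Λ r, dualPairing_algebraMap_smul]
  let B : (M →ₗ[Λ] L) →ₗ[R] (((P₀ →ₗ[Λᵐᵒᵖ] Λ) →ₗ[Λ] M) →ₗ[R] dualizingModule R) :=
    LinearMap.mk₂ R (fun h θ => tracePairing p x ξ (h ∘ₗ θ))
      (fun h h' θ => by rw [LinearMap.add_comp, map_add])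
      (fun r h θ => by rw [LinearMap.smul_comp, halg])
      (fun h θ θ' => by rw [LinearMap.comp_add, map_add])
      (fun r h θ => by
        rw [← halg]
        congr 1
        ext ζ
        change h (r • θ ζ) = r • h (θ ζ)
        rw [← algebraMap_smul Λ r, map_smul, algebraMap_smul])
  have hB : Function.Injective B := by
    rw [← LinearMap.ker_eq_bot, eq_bot_iff]
    intro h hh
    refine LinearMap.ext fun m => dualPairing_separating (R := R) (Λ := Λ) fun u => ?_
    obtain ⟨z, rfl⟩ := hp u
    have h1 : tracePairing p x ξ (h ∘ₗ evalSMul z m) = 0 :=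
      LinearMap.congr_fun (LinearMap.mem_ker.1 hh) (evalSMul z m)
    have h2 : h ∘ₗ evalSMul z m = evalSMul z (h m) := by
      ext ζ
      simp [evalSMul]
    rw [h2, tracePairing_evalSMul hx] at h1
    rw [h1, LinearMap.zero_apply, map_zero]
  have := dualizingModule_injective R
  obtain ⟨ω, hω⟩ := Module.Injective.out B hB lam
  obtain ⟨θ, hθ⟩ := exists_eval_eq R ω
  exact ⟨θ, fun h => by rw [← hω h, hθ]; rfl⟩

end Trace

/-! ### Almost split sequences -/

section AlmostSplit

/-- If every map from `L` which is not a split monomorphism extends along the non-split monomorphism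
`j : L → E`, then every map to the cokernel `N` which is not a split epimorphism lifts to `E`,
provided that the endomorphisms of `N` are invertible or nilpotent. -/
theorem exists_lift_of_left_almostSplit {Λ : Type u} [Ring Λ] {L E N : Type u} [AddCommGroup L]
    [Module Λ L] [AddCommGroup E] [Module Λ E] [AddCommGroup N] [Module Λ N]
    {j : L →ₗ[Λ] E} {e : E →ₗ[Λ] N} (hj : Function.Injective j) (he : Function.Surjective e)
    (hje : LinearMap.range j = LinearMap.ker e)
    (hns : ¬ ∃ r : E →ₗ[Λ] L, r ∘ₗ j = LinearMap.id)
    (hleft : ∀ (M : Type u) [AddCommGroup M] [Module Λ M] (u : L →ₗ[Λ] M),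
      (¬ ∃ r : M →ₗ[Λ] L, r ∘ₗ u = LinearMap.id) → ∃ v : E →ₗ[Λ] M, v ∘ₗ j = u)
    (hN : ∀ ω : Module.End Λ N, IsUnit ω ∨ IsNilpotent ω)
    {C : Type u} [AddCommGroup C] [Module Λ C] (ψ : C →ₗ[Λ] N)
    (hψ : ¬ ∃ s : N →ₗ[Λ] C, ψ ∘ₗ s = LinearMap.id) : ∃ χ : C →ₗ[Λ] E, e ∘ₗ χ = ψ := by
  have hej : ∀ l, e (j l) = 0 := fun l => by
    have : j l ∈ LinearMap.ker e := hje ▸ LinearMap.mem_range_self j l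
    exact this
  -- Pull the sequence back along `ψ`. If `L → F` splits, then `ψ` lifts; otherwise `L → F` extends
  -- to `E` by `hleft`, which is refuted below.
  let F : Submodule Λ (C × E) := LinearMap.eqLocus (ψ ∘ₗ LinearMap.fst Λ C E)
    (e ∘ₗ LinearMap.snd Λ C E)
  let u : L →ₗ[Λ] F := (LinearMap.inr Λ C E ∘ₗ j).codRestrict F fun l => by
    change ψ 0 = e (j l)
    rw [map_zero, hej]
  let pC : F →ₗ[Λ] C := LinearMap.fst Λ C E ∘ₗ F.subtype
  let pE : F →ₗ[Λ] E := LinearMap.snd Λ C E ∘ₗ F.subtype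
  have hpCE : ∀ z, ψ (pC z) = e (pE z) := fun z => z.2
  have hpCu : ∀ l, pC (u l) = 0 := fun l => rfl
  have hpEu : ∀ l, pE (u l) = j l := fun l => rfl
  by_cases hu : ∃ r : F →ₗ[Λ] L, r ∘ₗ u = LinearMap.id
  · obtain ⟨r, hr⟩ := hu
    have hr' : ∀ l, r (u l) = l := LinearMap.congr_fun hr
    have hpC : Function.Surjective pC := fun c => by
      obtain ⟨x, hx⟩ := he (ψ c)
      exact ⟨⟨(c, x), hx.symm⟩, rfl⟩
    obtain ⟨χ, hχ⟩ := exists_comp_eq_of_ker_le_ker hpC (u := pE - j ∘ₗ r) (by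
      intro z hz
      have hz' : pC z = 0 := hz
      have h1 : pE z ∈ LinearMap.ker e := by rw [LinearMap.mem_ker, ← hpCE, hz', map_zero]
      rw [← hje] at h1
      obtain ⟨l, hl⟩ := h1
      have h2 : z = u l := Subtype.ext (Prod.ext hz' hl.symm)
      change pE z - j (r z) = 0
      rw [h2, hr', hpEu, sub_self])
    refine ⟨χ, LinearMap.ext fun c => ?_⟩
    obtain ⟨z, rfl⟩ := hpC c
    have : χ (pC z) = pE z - j (r z) := LinearMap.congr_fun hχ z
    rw [LinearMap.comp_apply, this, map_sub, hej, sub_zero, hpCE]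
  · exfalso
    obtain ⟨v, hv⟩ := hleft F u hu
    have hv' : ∀ l, v (j l) = u l := LinearMap.congr_fun hv
    obtain ⟨t, ht⟩ := exists_comp_eq_of_ker_le_ker he (u := pC ∘ₗ v) (by
      rw [← hje]
      rintro _ ⟨l, rfl⟩
      rw [LinearMap.mem_ker, LinearMap.comp_apply, hv', hpCu])
    have ht' : ∀ x, t (e x) = pC (v x) := LinearMap.congr_fun ht
    -- An endomorphism of the sequence: identity on `L`, `ψ t` on `N`. If `ψ t` is invertible, `ψ`
    -- splits; if it is nilpotent, a power of `w` retracts `E` onto `L`.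
    let w : Module.End Λ E := pE ∘ₗ v
    have hwj : ∀ l, w (j l) = j l := fun l => by
      change pE (v (j l)) = j l
      rw [hv', hpEu]
    have hew : ∀ x, (ψ ∘ₗ t) (e x) = e (w x) := fun x => by
      rw [LinearMap.comp_apply, ht', hpCE]
      rfl
    rcases hN (ψ ∘ₗ t) with ⟨ω, hω⟩ | ⟨n, hn⟩
    · apply hψ
      refine ⟨t ∘ₗ (↑ω⁻¹ : Module.End Λ N), ?_⟩
      rw [← LinearMap.comp_assoc, ← hω]
      exact ω.mul_inv
    · apply hns
      have hwn : ∀ (n : ℕ) (x : E), ((ψ ∘ₗ t : Module.End Λ N) ^ n) (e x) = e ((w ^ n) x) := by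
        intro n
        induction n with
        | zero => exact fun x => rfl
        | succ n ih =>
          intro x
          rw [pow_succ, Module.End.mul_apply, hew, ih, pow_succ, Module.End.mul_apply]
      have hwnj : ∀ (n : ℕ) (l : L), (w ^ n) (j l) = j l := by
        intro n
        induction n with
        | zero => exact fun x => rfl
        | succ n ih =>
          intro x
          rw [pow_succ, Module.End.mul_apply, hwj, ih]
      obtain ⟨r, hr⟩ := exists_comp_eq_of_range_le_range_of_injective hj (g := w ^ n) (by
        rw [hje]
        rintro _ ⟨x, rfl⟩
        rw [LinearMap.mem_ker, ← hwn, hn, LinearMap.zero_apply])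
      refine ⟨r, LinearMap.ext fun l => hj ?_⟩
      have : j (r (j l)) = (w ^ n) (j l) := LinearMap.congr_fun hr (j l)
      rw [LinearMap.comp_apply, this, hwnj, LinearMap.id_apply]

variable {R Λ : Type u} [CommRing R] [Ring Λ] [Algebra R Λ] [IsArtinianRing R]

/-- In a local endomorphism ring the non-units form a proper `R`-submodule, so `J` separates `1`
from it. This functional selects the socle-type class that defines the almost split sequence. -/
theorem exists_functional_end {L : Type u} [AddCommGroup L] [Module Λ L] [Module R L]
    [IsScalarTower R Λ L] [SMulCommClass Λ R L] [hL : IsLocalRing (Module.End Λ L)] :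
    ∃ lam : Module.End Λ L →ₗ[R] dualizingModule R, lam 1 ≠ 0 ∧ ∀ a, ¬ IsUnit a → lam a = 0 := by
  let m : Submodule R (Module.End Λ L) :=
    { carrier := {a | ¬ IsUnit a}
      add_mem' := fun {a b} ha hb hab => (isUnit_or_isUnit_of_isUnit_add hab).elim ha hb
      zero_mem' := not_isUnit_zero
      smul_mem' := by
        rintro r a ha ⟨w, hw⟩
        refine ha ⟨⟨a, r • ↑w⁻¹, ?_, ?_⟩, rfl⟩
        · have h : (r • a) * (↑w⁻¹ : Module.End Λ L) = 1 := by rw [← hw, Units.mul_inv]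
          rw [← h]
          ext x
          change a (r • (↑w⁻¹ : Module.End Λ L) x) = r • a ((↑w⁻¹ : Module.End Λ L) x)
          rw [← algebraMap_smul Λ r, map_smul, algebraMap_smul]
        · have h : (↑w⁻¹ : Module.End Λ L) * (r • a) = 1 := by rw [← hw, Units.inv_mul]
          rw [← h]
          ext x
          change r • (↑w⁻¹ : Module.End Λ L) (a x) = (↑w⁻¹ : Module.End Λ L) (r • a x)
          rw [← algebraMap_smul Λ r (a x), map_smul, algebraMap_smul] }
  have h1 : m.mkQ 1 ≠ 0 := fun h => (Submodule.Quotient.mk_eq_zero m).1 h isUnit_one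
  obtain ⟨μ, hμ⟩ := exists_functional_ne_zero R h1
  refine ⟨μ ∘ₗ m.mkQ, hμ, fun a ha => ?_⟩
  have : m.mkQ a = 0 := (Submodule.Quotient.mk_eq_zero m).2 ha
  rw [LinearMap.comp_apply, this, map_zero]

variable [Module.Finite R Λ]

/-- Represent the functional on `End L` by `θ : P₀* → L`. It does not factor through `f*`, since the
functional is nonzero at `1`; but `u θ` does for every `u` that is not a split monomorphism, since
then every `k u` is a non-unit. The pushout `E` of `θ` and `f*` is therefore the almost split
extension of `Tr D(L)` by `L`, and `φ` is induced by extending `i` to `E`. -/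
theorem IsMinimalPresentation.exists_almostSplit {L : Type u} [AddCommGroup L] [Module Λ L]
    [Module.Finite Λ L] (hL : Indecomposable Λ L) {P₁ P₀ : Type u} [AddCommGroup P₁]
    [Module Λᵐᵒᵖ P₁] [AddCommGroup P₀] [Module Λᵐᵒᵖ P₀] {f : P₁ →ₗ[Λᵐᵒᵖ] P₀}
    {p : P₀ →ₗ[Λᵐᵒᵖ] Dual R Λ L} (h : IsMinimalPresentation f p)
    {Z W : Type u} [AddCommGroup Z] [Module Λ Z] [AddCommGroup W] [Module Λ W]
    {i : L →ₗ[Λ] Z} {g : Z →ₗ[Λ] W} (hi : Function.Injective i)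
    (hig : LinearMap.range i = LinearMap.ker g)
    (hns : ¬ ∃ r : Z →ₗ[Λ] L, r ∘ₗ i = LinearMap.id) :
    ∃ φ : TransposeOf f →ₗ[Λ] W, ¬ FactorsThrough g φ ∧
      ∀ (C : Type u) [AddCommGroup C] [Module Λ C] (ψ : C →ₗ[Λ] TransposeOf f),
        (¬ ∃ s, ψ ∘ₗ s = LinearMap.id) → FactorsThrough g (φ ∘ₗ ψ) := by
  have : IsArtinianRing Λ := IsArtinianRing.of_finite R Λ
  have := h.finite₁
  have := h.finite₀
  have := h.cover₀.projective
  have := h.cover₁.projective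
  obtain ⟨n₁, y, η, hη⟩ := exists_isDualBasis Λ P₁
  obtain ⟨n₀, x, ξ, hξ⟩ := exists_isDualBasis Λ P₀
  have := hη.finite_dual
  have := hL.isLocalRing
  let _ : Module R L := Module.compHom L (algebraMap R Λ)
  have : IsScalarTower R Λ L := isScalarTower_compHom
  have : SMulCommClass Λ R L := IsScalarTower.to_smulCommClass'
  let fs := LinearMap.lcomp Λ Λ f
  let π := (LinearMap.range fs).mkQ
  have hπ : Function.Surjective π := Submodule.mkQ_surjective _
  have hπf : ∀ ζ, π (fs ζ) = 0 := fun ζ => (Submodule.Quotient.mk_eq_zero _).2 ⟨ζ, rfl⟩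
  have hπ0 : ∀ q, π q = 0 → ∃ ζ, fs ζ = q := fun q hq => (Submodule.Quotient.mk_eq_zero _).1 hq
  have hpf : ∀ z, p (f z) = 0 := fun z => by
    have : f z ∈ LinearMap.ker p := h.exact ▸ LinearMap.mem_range_self f z
    exact this
  obtain ⟨lam, hlam1, hlam⟩ := exists_functional_end (R := R) (Λ := Λ) (L := L)
  obtain ⟨θ, hθ⟩ := exists_tracePairing_eq hξ h.cover₀.surjective lam
  have hθ0 : ¬ ∃ σ, σ ∘ₗ fs = θ := by
    rintro ⟨σ, rfl⟩
    apply hlam1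
    rw [← hθ]
    exact tracePairing_comp_lcomp hξ hη hpf σ
  have hsplit : ∀ (M : Type u) [AddCommGroup M] [Module Λ M] (u : L →ₗ[Λ] M),
      (¬ ∃ r : M →ₗ[Λ] L, r ∘ₗ u = LinearMap.id) → ∃ σ, σ ∘ₗ fs = u ∘ₗ θ := by
    intro M _ _ u hu
    refine exists_factor_of_tracePairing_eq_zero hξ h.cover₀.surjective h.exact _ fun k => ?_
    rw [← LinearMap.comp_assoc, hθ (k ∘ₗ u)]
    refine hlam _ fun hk => hu ?_
    obtain ⟨w, hw⟩ := hk
    refine ⟨(↑w⁻¹ : Module.End Λ L) ∘ₗ k, ?_⟩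
    rw [LinearMap.comp_assoc, ← hw]
    exact w.inv_mul
  obtain ⟨σ, hσ⟩ := hsplit Z i hns
  have hσ' : ∀ ζ, σ (fs ζ) = i (θ ζ) := LinearMap.congr_fun hσ
  have hgi : ∀ l, g (i l) = 0 := fun l => by
    have : i l ∈ LinearMap.ker g := hig ▸ LinearMap.mem_range_self i l
    exact this
  let φ : TransposeOf f →ₗ[Λ] W := (LinearMap.range fs).liftQ (g ∘ₗ σ) (by
    rintro _ ⟨ζ, rfl⟩
    rw [LinearMap.mem_ker, LinearMap.comp_apply, hσ', hgi])
  have hφ : ∀ q, φ (π q) = g (σ q) := fun q => rfl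
  let G := LinearMap.range (θ.prod (-fs))
  let E := (L × (P₁ →ₗ[Λᵐᵒᵖ] Λ)) ⧸ G
  let j : L →ₗ[Λ] E := G.mkQ ∘ₗ LinearMap.inl Λ L _
  let ext : ∀ (M : Type u) [AddCommGroup M] [Module Λ M] (u : L →ₗ[Λ] M)
      (τ : (P₁ →ₗ[Λᵐᵒᵖ] Λ) →ₗ[Λ] M), τ ∘ₗ fs = u ∘ₗ θ → (E →ₗ[Λ] M) :=
    fun M _ _ u τ hτ => G.liftQ (u.coprod τ) (by
      rintro _ ⟨ζ, rfl⟩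
      have : τ (fs ζ) = u (θ ζ) := LinearMap.congr_fun hτ ζ
      change u (θ ζ) + τ (-(fs ζ)) = 0
      rw [map_neg, this, add_neg_cancel])
  have hext : ∀ (M : Type u) [AddCommGroup M] [Module Λ M] (u : L →ₗ[Λ] M)
      (τ : (P₁ →ₗ[Λᵐᵒᵖ] Λ) →ₗ[Λ] M) (hτ : τ ∘ₗ fs = u ∘ₗ θ) (z : L × (P₁ →ₗ[Λᵐᵒᵖ] Λ)),
      ext M u τ hτ (G.mkQ z) = u z.1 + τ z.2 := fun M _ _ u τ hτ z => rfl
  have hextj : ∀ (M : Type u) [AddCommGroup M] [Module Λ M] (u : L →ₗ[Λ] M)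
      (τ : (P₁ →ₗ[Λᵐᵒᵖ] Λ) →ₗ[Λ] M) (hτ : τ ∘ₗ fs = u ∘ₗ θ), ext M u τ hτ ∘ₗ j = u := by
    intro M _ _ u τ hτ
    refine LinearMap.ext fun l => ?_
    refine (hext M u τ hτ (l, 0)).trans ?_
    rw [map_zero, add_zero]
  let e : E →ₗ[Λ] TransposeOf f := ext _ 0 π (LinearMap.ext hπf)
  have he : ∀ z, e (G.mkQ z) = π z.2 := fun z =>
    (hext _ 0 π (LinearMap.ext hπf) z).trans (zero_add _)
  have hE : ∀ z : E, g (ext Z i σ hσ z) = φ (e z) := fun z => by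
    obtain ⟨z, rfl⟩ := G.mkQ_surjective z
    rw [he, hφ, hext Z i σ hσ, map_add, hgi, zero_add]
  refine ⟨φ, ?_, fun C _ _ ψ hψ => ?_⟩
  · rintro ⟨γ, hγ⟩
    have hγ' : ∀ z, g (γ z) = φ z := LinearMap.congr_fun hγ
    -- A lift `γ` of `φ` would make `σ - γ π` land in `L`, and restricting along `f*` would factor
    -- `θ`.
    obtain ⟨ρ, hρ⟩ := exists_comp_eq_of_range_le_range_of_injective hi (g := σ - γ ∘ₗ π) (by
      rw [hig]
      rintro _ ⟨q, rfl⟩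
      rw [LinearMap.mem_ker, LinearMap.sub_apply, LinearMap.comp_apply, map_sub, hγ', hφ,
        sub_self])
    refine hθ0 ⟨ρ, LinearMap.ext fun ζ => hi ?_⟩
    have : i (ρ (fs ζ)) = σ (fs ζ) - γ (π (fs ζ)) := LinearMap.congr_fun hρ (fs ζ)
    rw [LinearMap.comp_apply, this, hπf, map_zero, sub_zero, hσ']
  · have hlift : ∃ χ : C →ₗ[Λ] E, e ∘ₗ χ = ψ := by
      refine exists_lift_of_left_almostSplit (j := j) (e := e) ?_ ?_ ?_ ?_ ?_
        (h.isUnit_or_isNilpotent_end_transposeOf hL) ψ hψ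
      -- `f*` need not be injective, so injectivity of `j` is inherited from `i`, which extends
      -- along `j`.
      · intro a b hab
        apply hi
        have h1 : ∀ l, ext Z i σ hσ (j l) = i l := LinearMap.congr_fun (hextj Z i σ hσ)
        rw [← h1, ← h1, hab]
      · intro z
        obtain ⟨q, rfl⟩ := hπ z
        exact ⟨G.mkQ (0, q), he _⟩
      · apply le_antisymm
        · rintro _ ⟨l, rfl⟩
          exact LinearMap.congr_fun (hextj _ 0 π (LinearMap.ext hπf)) l
        · intro z hz
          obtain ⟨⟨l, q⟩, rfl⟩ := G.mkQ_surjective z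
          rw [LinearMap.mem_ker, he] at hz
          obtain ⟨ζ, hζ⟩ := hπ0 q hz
          refine ⟨l + θ ζ, ?_⟩
          refine (Submodule.Quotient.eq G).2 ⟨ζ, ?_⟩
          refine Prod.ext ?_ ?_
          · change θ ζ = l + θ ζ - l
            rw [add_sub_cancel_left]
          · change -(fs ζ) = 0 - q
            rw [hζ, zero_sub]
      · rintro ⟨r, hr⟩
        refine hθ0 ⟨r ∘ₗ G.mkQ ∘ₗ LinearMap.inr Λ L _, LinearMap.ext fun ζ => ?_⟩
        have h1 : G.mkQ (0, fs ζ) = j (θ ζ) := (Submodule.Quotient.eq G).2 ⟨-ζ, by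
          refine Prod.ext ?_ ?_
          · change θ (-ζ) = 0 - θ ζ
            rw [map_neg, zero_sub]
          · change -(fs (-ζ)) = fs ζ - 0
            rw [map_neg, neg_neg, sub_zero]⟩
        change r (G.mkQ (0, fs ζ)) = θ ζ
        rw [h1]
        exact LinearMap.congr_fun hr (θ ζ)
      · intro M _ _ u hu
        obtain ⟨τ, hτ⟩ := hsplit M u hu
        exact ⟨ext M u τ hτ, hextj M u τ hτ⟩
    obtain ⟨χ, hχ⟩ := hlift
    refine ⟨ext Z i σ hσ ∘ₗ χ, LinearMap.ext fun c => ?_⟩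
    have : e (χ c) = ψ c := LinearMap.congr_fun hχ c
    rw [LinearMap.comp_apply, LinearMap.comp_apply, hE, this, LinearMap.comp_apply]

variable {L N : Type u} [AddCommGroup L] [Module Λ L] [Module.Finite Λ L] [AddCommGroup N]
  [Module Λ N]

/-- For a non-split monomorphism `L → Z` with cokernel inside `W` and `L` indecomposable, there is
`φ : Tr D(L) → W` which does not lift to `Z`, while `φψ` lifts to `Z` for all `ψ` which are not
split epimorphisms. -/
theorem IsTrD.exists_almostSplit (hN : IsTrD R Λ L N) (hL : Indecomposable Λ L)
    {Z W : Type u} [AddCommGroup Z] [Module Λ Z] [AddCommGroup W] [Module Λ W]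
    {i : L →ₗ[Λ] Z} {g : Z →ₗ[Λ] W} (hi : Function.Injective i)
    (hig : LinearMap.range i = LinearMap.ker g)
    (hns : ¬ ∃ r : Z →ₗ[Λ] L, r ∘ₗ i = LinearMap.id) :
    ∃ φ : N →ₗ[Λ] W, ¬ FactorsThrough g φ ∧
      ∀ (C : Type u) [AddCommGroup C] [Module Λ C] (ψ : C →ₗ[Λ] N),
        (¬ ∃ s, ψ ∘ₗ s = LinearMap.id) → FactorsThrough g (φ ∘ₗ ψ) := by
  obtain ⟨P₁, P₀, f, p, h, ⟨e⟩⟩ := hN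
  obtain ⟨φ, hφ, hφψ⟩ := h.exists_almostSplit hL hi hig hns
  refine ⟨φ ∘ₗ e.toLinearMap, ?_, fun C _ _ ψ hψ => ?_⟩
  · rintro ⟨γ, hγ⟩
    refine hφ ⟨γ ∘ₗ e.symm.toLinearMap, ?_⟩
    rw [← LinearMap.comp_assoc, hγ, LinearMap.comp_assoc, LinearEquiv.comp_symm,
      LinearMap.comp_id]
  · rw [LinearMap.comp_assoc]
    refine hφψ C (e.toLinearMap ∘ₗ ψ) ?_
    rintro ⟨s, hs⟩
    refine hψ ⟨s ∘ₗ e.toLinearMap, LinearMap.ext fun x => e.injective ?_⟩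
    exact LinearMap.congr_fun hs (e x)

theorem IsTrD.isLocalRing (hN : IsTrD R Λ L N) (hL : Indecomposable Λ L) [Nontrivial N] :
    IsLocalRing (Module.End Λ N) := by
  obtain ⟨P₁, P₀, f, p, h, ⟨e⟩⟩ := hN
  refine isLocalRing_end_of_isUnit_or_isNilpotent fun a => ?_
  have := h.isUnit_or_isNilpotent_end_transposeOf hL (e.conjRingEquiv a)
  rwa [MulEquiv.isUnit_map, IsNilpotent.map_iff e.conjRingEquiv.injective] at this

end AlmostSplit

/-! ### Factoring through a morphism -/

section Factoring

variable {Λ : Type u} [Ring Λ] {X Y : Type u} [AddCommGroup X] [Module Λ X]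
  [AddCommGroup Y] [Module Λ Y] {α : X →ₗ[Λ] Y}

theorem FactorsThrough.comp {Z Z' : Type u} [AddCommGroup Z] [Module Λ Z] [AddCommGroup Z']
    [Module Λ Z'] {β : Z →ₗ[Λ] Y} (h : FactorsThrough α β) (ψ : Z' →ₗ[Λ] Z) :
    FactorsThrough α (β ∘ₗ ψ) := by
  obtain ⟨γ, rfl⟩ := h
  exact ⟨γ ∘ₗ ψ, rfl⟩

theorem FactorsThrough.range_le {Z : Type u} [AddCommGroup Z] [Module Λ Z] {β : Z →ₗ[Λ] Y}
    (h : FactorsThrough α β) : LinearMap.range β ≤ LinearMap.range α := by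
  obtain ⟨γ, rfl⟩ := h
  exact LinearMap.range_comp_le_range _ _

/-- The `X₀`-component of a factorization is killed by `α` and can be projected away. -/
theorem factorsThrough_domRestrict_iff {X₀ X₁ : Submodule Λ X} (hc : IsCompl X₀ X₁)
    (h₀ : X₀ ≤ LinearMap.ker α) {Z : Type u} [AddCommGroup Z] [Module Λ Z] (β : Z →ₗ[Λ] Y) :
    FactorsThrough (α.domRestrict X₁) β ↔ FactorsThrough α β := by
  constructor
  · rintro ⟨γ, rfl⟩
    exact ⟨X₁.subtype ∘ₗ γ, rfl⟩
  · rintro ⟨γ, rfl⟩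
    refine ⟨Submodule.projectionOnto X₁ X₀ hc.symm ∘ₗ γ, LinearMap.ext fun z => ?_⟩
    have h : γ z - Submodule.projectionOnto X₁ X₀ hc.symm (γ z) ∈ X₀ := by
      rw [← Submodule.projectionOnto_apply_eq_zero_iff hc.symm, map_sub,
        Submodule.projectionOnto_apply_left, sub_self]
    have h' := h₀ h
    rw [LinearMap.mem_ker, map_sub, sub_eq_zero] at h'
    exact h'.symm

theorem rightDetermined_domRestrict_iff {X₀ X₁ : Submodule Λ X} (hc : IsCompl X₀ X₁)
    (h₀ : X₀ ≤ LinearMap.ker α) (C : Type u) [AddCommGroup C] [Module Λ C] :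
    RightDetermined (α.domRestrict X₁) C ↔ RightDetermined α C := by
  simp only [RightDetermined, factorsThrough_domRestrict_iff hc h₀]

theorem IsSummandOf.factorsThrough {N C X' : Type u} [AddCommGroup N] [Module Λ N]
    [AddCommGroup C] [Module Λ C] [AddCommGroup X'] [Module Λ X'] {α' : X' →ₗ[Λ] Y}
    (h : IsSummandOf Λ N C) (hC : ∀ φ : C →ₗ[Λ] X', FactorsThrough α (α' ∘ₗ φ))
    (φ : N →ₗ[Λ] X') : FactorsThrough α (α' ∘ₗ φ) := by
  obtain ⟨i, r, hir⟩ := h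
  have h1 := (hC (φ ∘ₗ r)).comp i
  rwa [LinearMap.comp_assoc, LinearMap.comp_assoc, hir, LinearMap.comp_id] at h1

/-- If `η : N → Y` does not factor through `α`, but `ηψ` does for all `ψ` which are not split
epimorphisms, then `N` is a direct summand of every module which right determines `α`. -/
theorem RightDetermined.isSummandOf {C N : Type u} [AddCommGroup C] [Module Λ C]
    [AddCommGroup N] [Module Λ N] [Module.Finite Λ N] (hC : RightDetermined α C)
    {η : N →ₗ[Λ] Y} (hη : ¬ FactorsThrough α η)
    (hψ : ∀ ψ : C →ₗ[Λ] N, (¬ ∃ s, ψ ∘ₗ s = LinearMap.id) → FactorsThrough α (η ∘ₗ ψ)) :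
    IsSummandOf Λ N C := by
  by_contra h
  refine hη (hC N η fun ψ => hψ ψ ?_)
  rintro ⟨s, hs⟩
  exact h ⟨s, ψ, hs⟩

/-- Since `ψ g` is a non-unit, `1 - ψ g` is invertible, and `1 + g (1 - ψ g)⁻¹ ψ` inverts `1 - g ψ`.
-/
theorem isRadicalMap_of_isLocalRing {M N : Type u} [AddCommGroup M] [Module Λ M] [AddCommGroup N]
    [Module Λ N] [IsLocalRing (Module.End Λ N)] {ψ : M →ₗ[Λ] N}
    (hψ : ¬ ∃ s, ψ ∘ₗ s = LinearMap.id) : IsRadicalMap ψ := by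
  intro g
  have hng : ¬ IsUnit (ψ ∘ₗ g : Module.End Λ N) := by
    rintro ⟨w, hw⟩
    refine hψ ⟨g ∘ₗ (↑w⁻¹ : Module.End Λ N), ?_⟩
    rw [← LinearMap.comp_assoc, ← hw]
    exact w.mul_inv
  obtain ⟨w, hw⟩ := (isUnit_or_isUnit_of_isUnit_add (a := (ψ ∘ₗ g : Module.End Λ N))
    (b := 1 - (ψ ∘ₗ g : Module.End Λ N)) (by simp)).resolve_left hng
  have hw' : ∀ x, (w : Module.End Λ N) x = x - ψ (g x) := fun x => by rw [hw]; rfl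
  have h1 : ∀ x, (↑w⁻¹ : Module.End Λ N) (x - ψ (g x)) = x := fun x => by
    rw [← hw']
    exact LinearMap.congr_fun w.inv_mul x
  have h2 : ∀ x, (↑w⁻¹ : Module.End Λ N) x - ψ (g ((↑w⁻¹ : Module.End Λ N) x)) = x := fun x => by
    rw [← hw']
    exact LinearMap.congr_fun w.mul_inv x
  refine ⟨⟨_, 1 + g ∘ₗ (↑w⁻¹ : Module.End Λ N) ∘ₗ ψ, ?_, ?_⟩, rfl⟩
  · refine LinearMap.ext fun x => ?_
    change (x + g ((↑w⁻¹ : Module.End Λ N) (ψ x))) -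
      g (ψ (x + g ((↑w⁻¹ : Module.End Λ N) (ψ x)))) = x
    have := congrArg g (h2 (ψ x))
    rw [map_sub] at this
    rw [map_add, map_add]
    rw [← this]
    abel
  · refine LinearMap.ext fun x => ?_
    change (x - g (ψ x)) + g ((↑w⁻¹ : Module.End Λ N) (ψ (x - g (ψ x)))) = x
    rw [map_sub ψ, h1, sub_add_cancel]

theorem AlmostFactorsThrough.isSummandOf [IsArtinianRing Λ] {C N : Type u} [AddCommGroup C]
    [Module Λ C] [Module.Finite Λ C] [AddCommGroup N] [Module Λ N] [Module.Finite Λ N]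
    (hN : AlmostFactorsThrough α N) (hC : RightDetermined α C) : IsSummandOf Λ N C := by
  obtain ⟨hind, η, hη, hrad⟩ := hN
  have := hind.isLocalRing
  exact hC.isSummandOf hη fun ψ hψ => hrad C ψ (isRadicalMap_of_isLocalRing hψ)

end Factoring

/-! ### The transposes of the duals of the summands of the kernel -/

section Kernel

variable {R Λ : Type u} [CommRing R] [Ring Λ] [Algebra R Λ] [IsArtinianRing R]
  [Module.Finite R Λ] {X Y : Type u} [AddCommGroup X] [Module Λ X]
  [AddCommGroup Y] [Module Λ Y] {α : X →ₗ[Λ] Y} {K : Type u} [AddCommGroup K] [Module Λ K]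
  {k : K →ₗ[Λ] X}

/-- If `L` is an indecomposable summand of the kernel of a right minimal morphism `α`, then
`Tr D(L)` almost factors through `α`. -/
theorem IsRightMinimal.exists_not_factorsThrough (hα : IsRightMinimal α)
    (hk : Function.Injective k) (hkα : LinearMap.range k = LinearMap.ker α)
    {L L' : Submodule Λ K} (hLL' : IsCompl L L') [Module.Finite Λ L] (hL : Indecomposable Λ L)
    {N : Type u} [AddCommGroup N] [Module Λ N] (hN : IsTrD R Λ L N) :
    ∃ η : N →ₗ[Λ] Y, ¬ FactorsThrough α η ∧
      ∀ (C : Type u) [AddCommGroup C] [Module Λ C] (ψ : C →ₗ[Λ] N),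
        (¬ ∃ s, ψ ∘ₗ s = LinearMap.id) → FactorsThrough α (η ∘ₗ ψ) := by
  have hαk : ∀ x, α (k x) = 0 := fun x => by
    have : k x ∈ LinearMap.ker α := hkα ▸ LinearMap.mem_range_self k x
    exact this
  let i : L →ₗ[Λ] X := k ∘ₗ L.subtype
  have hi : Function.Injective i := hk.comp L.injective_subtype
  have hns : ¬ ∃ r : X →ₗ[Λ] L, r ∘ₗ i = LinearMap.id := by
    rintro ⟨r, hr⟩
    have hr' : ∀ l, r (i l) = l := LinearMap.congr_fun hr
    have hbot : LinearMap.range i = ⊥ := by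
      refine hα _ (LinearMap.ker r) ⟨?_, ?_⟩ ?_
      · rw [disjoint_iff, eq_bot_iff]
        rintro _ ⟨⟨l, rfl⟩, hl⟩
        have hl' : r (i l) = 0 := hl
        rw [hr'] at hl'
        rw [hl', map_zero]
        exact Submodule.zero_mem _
      · rw [codisjoint_iff, eq_top_iff]
        intro x _
        refine Submodule.mem_sup.2 ⟨i (r x), ⟨_, rfl⟩, x - i (r x), ?_, by abel⟩
        rw [LinearMap.mem_ker, map_sub, hr', sub_self]
      · rintro _ ⟨l, rfl⟩
        exact hαk _
    have := hL.1
    obtain ⟨l, hl⟩ := exists_ne (0 : L)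
    apply hl
    apply hi
    rw [map_zero]
    exact LinearMap.congr_fun (LinearMap.range_eq_bot.1 hbot) l
  let g := (LinearMap.range i).mkQ
  obtain ⟨φ, hφ, hφψ⟩ := hN.exists_almostSplit hL (g := g) hi (Submodule.ker_mkQ _).symm hns
  let β : (X ⧸ LinearMap.range i) →ₗ[Λ] Y := (LinearMap.range i).liftQ α (by
    rintro _ ⟨l, rfl⟩
    exact hαk _)
  have hβ : ∀ x, β (g x) = α x := fun x => rfl
  refine ⟨β ∘ₗ φ, ?_, fun C _ _ ψ hψ => ?_⟩
  · rintro ⟨γ, hγ⟩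
    have hγ' : ∀ x, α (γ x) = β (φ x) := LinearMap.congr_fun hγ
    -- The kernel of `β` is `K / L`, a copy of `L'` that lifts to `X`. If `βφ = αγ`, then `φ - g γ`
    -- takes values there, and correcting `γ` by its lift would lift `φ` itself.
    have hinj : Function.Injective (g ∘ₗ k ∘ₗ L'.subtype) := by
      rw [← LinearMap.ker_eq_bot, eq_bot_iff]
      rintro ⟨x, hx⟩ h0
      obtain ⟨l, hl⟩ : k x ∈ LinearMap.range i := (Submodule.Quotient.mk_eq_zero _).1 h0
      have hlx : (l : K) = x := hk hl
      have : x ∈ L ⊓ L' := ⟨hlx ▸ l.2, hx⟩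
      rw [hLL'.inf_eq_bot] at this
      exact Subtype.ext this
    obtain ⟨κ, hκ⟩ := exists_comp_eq_of_range_le_range_of_injective hinj (g := φ - g ∘ₗ γ) (by
      rintro _ ⟨n, rfl⟩
      obtain ⟨x, hx⟩ := Submodule.mkQ_surjective _ (φ n)
      have h1 : x - γ n ∈ LinearMap.ker α := by
        rw [LinearMap.mem_ker, map_sub, hγ', ← hx, sub_eq_zero]
        rfl
      rw [← hkα] at h1
      obtain ⟨z, hz⟩ := h1
      have hz' : z ∈ L ⊔ L' := by rw [hLL'.sup_eq_top]; trivial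
      obtain ⟨a, ha, b, hb, rfl⟩ := Submodule.mem_sup.1 hz'
      refine ⟨⟨b, hb⟩, ?_⟩
      have ha0 : g (k a) = 0 := (Submodule.Quotient.mk_eq_zero _).2 ⟨⟨a, ha⟩, rfl⟩
      change g (k b) = φ n - g (γ n)
      rw [← hx]
      change g (k b) = g x - g (γ n)
      rw [← map_sub, ← hz, map_add, map_add, ha0, zero_add])
    refine hφ ⟨γ + k ∘ₗ L'.subtype ∘ₗ κ, LinearMap.ext fun n => ?_⟩
    have h2 : g (k (κ n)) = φ n - g (γ n) := LinearMap.congr_fun hκ n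
    change g (γ n + k (κ n)) = φ n
    rw [map_add, h2, add_sub_cancel]
  · obtain ⟨χ, hχ⟩ := hφψ C ψ hψ
    refine ⟨χ, LinearMap.ext fun c => ?_⟩
    have h1 : g (χ c) = φ (ψ c) := LinearMap.congr_fun hχ c
    change α (χ c) = β (φ (ψ c))
    rw [← h1, hβ]

/-- A morphism with image in the image of `α` factors through `α` if its composites with all
morphisms from the modules `Tr D(L)` do, where `L` runs through the summands in a decomposition of
the kernel of `α` into indecomposables. -/
theorem factorsThrough_of_forall_isTrD [Module.Finite Λ K] (hk : Function.Injective k)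
    (hkα : LinearMap.range k = LinearMap.ker α) {l : List (Module.End Λ K)}
    (hl : ∀ e ∈ l, IsIdempotentElem e ∧ Indecomposable Λ (LinearMap.range e)) (hs : l.sum = 1)
    {X' : Type u} [AddCommGroup X'] [Module Λ X'] {α' : X' →ₗ[Λ] Y}
    (hα' : LinearMap.range α' ≤ LinearMap.range α)
    (h : ∀ e ∈ l, ∃ N : ModuleCat.{u} Λ, IsTrD R Λ (LinearMap.range e) N ∧
      ∀ φ : N →ₗ[Λ] X', FactorsThrough α (α' ∘ₗ φ)) : FactorsThrough α α' := by
  have hαk : ∀ x, α (k x) = 0 := fun x => by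
    have : k x ∈ LinearMap.ker α := hkα ▸ LinearMap.mem_range_self k x
    exact this
  let Z : Submodule Λ (X × X') := LinearMap.eqLocus (α ∘ₗ LinearMap.fst Λ X X')
    (α' ∘ₗ LinearMap.snd Λ X X')
  let j : K →ₗ[Λ] Z := (LinearMap.inl Λ X X' ∘ₗ k).codRestrict Z fun x => by
    change α (k x) = α' 0
    rw [map_zero, hαk]
  let pX : Z →ₗ[Λ] X := LinearMap.fst Λ X X' ∘ₗ Z.subtype
  let pX' : Z →ₗ[Λ] X' := LinearMap.snd Λ X X' ∘ₗ Z.subtype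
  have hZ : ∀ z, α (pX z) = α' (pX' z) := fun z => z.2
  have hpXj : ∀ x, pX (j x) = k x := fun x => rfl
  have hpX'j : ∀ x, pX' (j x) = 0 := fun x => rfl
  have hker : ∀ z, pX' z = 0 → ∃ x, z = j x := fun z hz => by
    have h1 : pX z ∈ LinearMap.ker α := by rw [LinearMap.mem_ker, hZ, hz, map_zero]
    rw [← hkα] at h1
    obtain ⟨x, hx⟩ := h1
    exact ⟨x, Subtype.ext (Prod.ext hx.symm hz)⟩
  have hj : Function.Injective j := fun a b hab => hk (by rw [← hpXj, hab, hpXj])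
  have hext : ∀ e ∈ l, ∃ q : Z →ₗ[Λ] K, q ∘ₗ j = e := by
    intro e he
    obtain ⟨N, hN, hφ⟩ := h e he
    obtain ⟨hid, hind⟩ := hl e he
    have hee : ∀ x, e (e x) = e x := LinearMap.congr_fun hid
    by_contra hne
    -- `Z / U` is the pushout of the pullback extension along `K → range e`. If it is non-split,
    -- some `φ : N → X'` does not lift to it; but a factorization of `α' φ` through `α` lifts `φ` to
    -- `Z`.
    let U : Submodule Λ Z := (LinearMap.ker e).map j
    let i : LinearMap.range e →ₗ[Λ] (Z ⧸ U) := U.mkQ ∘ₗ j ∘ₗ (LinearMap.range e).subtype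
    have hmk : ∀ x, U.mkQ (j (e x)) = U.mkQ (j x) := fun x =>
      (Submodule.Quotient.eq U).2 ⟨e x - x, by
        rw [SetLike.mem_coe, LinearMap.mem_ker, map_sub, hee, sub_self], map_sub _ _ _⟩
    let g : (Z ⧸ U) →ₗ[Λ] X' := U.liftQ pX' (by
      rintro _ ⟨x, _, rfl⟩
      exact hpX'j x)
    have hi : Function.Injective i := by
      rw [← LinearMap.ker_eq_bot, eq_bot_iff]
      rintro ⟨_, x, rfl⟩ h0
      obtain ⟨y, hy, hyx⟩ : j (e x) ∈ U := (Submodule.Quotient.mk_eq_zero _).1 h0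
      have h1 : y = e x := hj hyx
      have h2 : e y = 0 := hy
      rw [h1, hee] at h2
      exact Subtype.ext h2
    have hig : LinearMap.range i = LinearMap.ker g := by
      apply le_antisymm
      · rintro _ ⟨x, rfl⟩
        exact hpX'j (x : K)
      · intro z hz
        obtain ⟨z, rfl⟩ := U.mkQ_surjective z
        obtain ⟨x, rfl⟩ := hker z hz
        exact ⟨e.rangeRestrict x, hmk x⟩
    have hns : ¬ ∃ r : (Z ⧸ U) →ₗ[Λ] LinearMap.range e, r ∘ₗ i = LinearMap.id := by
      rintro ⟨r, hr⟩
      refine hne ⟨(LinearMap.range e).subtype ∘ₗ r ∘ₗ U.mkQ, LinearMap.ext fun x => ?_⟩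
      have h1 : r (U.mkQ (j (e x))) = e.rangeRestrict x := LinearMap.congr_fun hr (e.rangeRestrict x)
      rw [hmk] at h1
      exact congrArg Subtype.val h1
    obtain ⟨φ, hφ', -⟩ := hN.exists_almostSplit hind hi hig hns
    obtain ⟨γ, hγ⟩ := hφ φ
    refine hφ' ⟨U.mkQ ∘ₗ (γ.prod φ).codRestrict Z fun n => LinearMap.congr_fun hγ n, ?_⟩
    exact LinearMap.ext fun n => rfl
  -- Adding the extensions of the idempotents extends their sum `1`, which splits the pullback.
  obtain ⟨r, hr⟩ : ∃ r : Z →ₗ[Λ] K, r ∘ₗ j = l.sum := by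
    clear hs hl h
    induction l with
    | nil => exact ⟨0, by simp⟩
    | cons e l ih =>
      obtain ⟨q, hq⟩ := hext e List.mem_cons_self
      obtain ⟨r, hr⟩ := ih fun e he => hext e (List.mem_cons_of_mem _ he)
      exact ⟨q + r, by rw [LinearMap.add_comp, hq, hr, List.sum_cons]⟩
  rw [hs] at hr
  have hr' : ∀ x, r (j x) = x := LinearMap.congr_fun hr
  have hpX' : Function.Surjective pX' := fun x' => by
    obtain ⟨x, hx⟩ := hα' ⟨x', rfl⟩
    exact ⟨⟨(x, x'), hx⟩, rfl⟩
  obtain ⟨γ, hγ⟩ := exists_comp_eq_of_ker_le_ker hpX' (u := pX - k ∘ₗ r) (by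
    intro z hz
    obtain ⟨x, rfl⟩ := hker z hz
    change pX (j x) - k (r (j x)) = 0
    rw [hr', hpXj, sub_self])
  refine ⟨γ, LinearMap.ext fun x' => ?_⟩
  obtain ⟨z, rfl⟩ := hpX' x'
  have h1 : γ (pX' z) = pX z - k (r z) := LinearMap.congr_fun hγ z
  rw [LinearMap.comp_apply, h1, map_sub, hαk, sub_zero, hZ]

end Kernel

/-! ### Projective modules almost factoring through a morphism -/

section Projective

variable {Λ : Type u} [Ring Λ] {X Y : Type u} [AddCommGroup X] [Module Λ X]
  [AddCommGroup Y] [Module Λ Y] {α : X →ₗ[Λ] Y}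

/-- A submodule mapping onto the simple `S` is all of `P`, and two complements cannot both map to
zero. -/
theorem IsProjectiveCover.indecomposable {P S : Type u} [AddCommGroup P] [Module Λ P]
    [AddCommGroup S] [Module Λ S] [IsSimpleModule Λ S] {p : P →ₗ[Λ] S}
    (hp : IsProjectiveCover p) : Indecomposable Λ P := by
  have : Nontrivial S := IsSimpleModule.nontrivial Λ S
  refine ⟨hp.surjective.nontrivial, fun U V hUV => ?_⟩
  have key : ∀ U : Submodule Λ P, U.map p = ⊤ → U = ⊤ := fun U hU => by
    apply hp.superfluous
    rw [← Submodule.comap_map_eq, hU, Submodule.comap_top]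
  rcases eq_bot_or_eq_top (U.map p) with h | h
  · rcases eq_bot_or_eq_top (V.map p) with h' | h'
    · exfalso
      have h1 : (U ⊔ V).map p = ⊥ := by rw [Submodule.map_sup, h, h', sup_bot_eq]
      rw [hUV.sup_eq_top, Submodule.map_top, LinearMap.range_eq_top.2 hp.surjective] at h1
      exact top_ne_bot h1
    · left
      have := hUV.inf_eq_bot
      rwa [key V h', inf_top_eq] at this
  · right
    have := hUV.inf_eq_bot
    rwa [key U h, top_inf_eq] at this

/-- Otherwise `ψ` is onto, hence split by some `s`; then `ψ` kills the automorphism `1 - s ψ`, so `ψ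
= 0`. -/
theorem IsProjectiveCover.comp_eq_zero_of_isRadicalMap {P S M : Type u} [AddCommGroup P]
    [Module Λ P] [AddCommGroup S] [Module Λ S] [IsSimpleModule Λ S] [AddCommGroup M] [Module Λ M]
    {p : P →ₗ[Λ] S} (hp : IsProjectiveCover p) {ψ : M →ₗ[Λ] P} (hψ : IsRadicalMap ψ) :
    p ∘ₗ ψ = 0 := by
  by_contra h
  have hsurj : Function.Surjective ψ := by
    rw [← LinearMap.range_eq_top]
    apply hp.superfluous
    rw [← Submodule.comap_map_eq, ← LinearMap.range_comp]
    rcases eq_bot_or_eq_top (LinearMap.range (p ∘ₗ ψ)) with h' | h'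
    · exact absurd (LinearMap.range_eq_bot.1 h') h
    · rw [h', Submodule.comap_top]
  have := hp.projective
  obtain ⟨s, hs⟩ := Module.projective_lifting_property ψ LinearMap.id hsurj
  obtain ⟨w, hw⟩ := hψ s
  have h1 : ψ ∘ₗ (w : Module.End Λ M) = 0 := by
    rw [hw, LinearMap.comp_sub, ← LinearMap.comp_assoc, hs, LinearMap.id_comp]
    exact sub_self _
  apply h
  have h2 : ψ = (ψ ∘ₗ (w : Module.End Λ M)) ∘ₗ (↑w⁻¹ : Module.End Λ M) := by
    rw [LinearMap.comp_assoc]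
    have : (w : Module.End Λ M) ∘ₗ (↑w⁻¹ : Module.End Λ M) = LinearMap.id := w.mul_inv
    rw [this, LinearMap.comp_id]
  rw [h2, h1, LinearMap.zero_comp, LinearMap.comp_zero]

/-- If the image of `α'` is not contained in the image of `α`, there is an indecomposable projective
module `P` and a map `φ : P → X'` such that the image of `α'φ` is not contained in the image of
`α`, whereas that of `α'φψ` is, for all radical maps `ψ` to `P`. -/
theorem exists_projective_of_not_range_le [IsArtinianRing Λ] {X' : Type u} [AddCommGroup X'] [Module Λ X']
    [Module.Finite Λ X'] {α' : X' →ₗ[Λ] Y} (h : ¬ LinearMap.range α' ≤ LinearMap.range α) :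
    ∃ (P : ModuleCat.{u} Λ) (φ : P →ₗ[Λ] X'), Module.Finite Λ P ∧ Module.Projective Λ P ∧
      Indecomposable Λ P ∧ ¬ LinearMap.range (α' ∘ₗ φ) ≤ LinearMap.range α ∧
      ∀ (M : Type u) [AddCommGroup M] [Module Λ M] (ψ : M →ₗ[Λ] P), IsRadicalMap ψ →
        LinearMap.range ((α' ∘ₗ φ) ∘ₗ ψ) ≤ LinearMap.range α := by
  let A : Submodule Λ X' := (LinearMap.range α).comap α'
  have hA : Nontrivial (X' ⧸ A) := by
    rw [Submodule.Quotient.nontrivial_iff]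
    intro hA
    apply h
    rintro _ ⟨x, rfl⟩
    have : x ∈ A := by rw [hA]; trivial
    exact this
  obtain ⟨S, hS⟩ := IsAtomic.exists_atom (Submodule Λ (X' ⧸ A))
  have hSs : IsSimpleModule Λ S := isSimpleModule_iff_isAtom.2 hS
  obtain ⟨P, p, hP, hp⟩ := exists_projectiveCover (S := Λ) S
  have := hp.projective
  obtain ⟨φ, hφ⟩ := Module.projective_lifting_property A.mkQ (S.subtype ∘ₗ p) A.mkQ_surjective
  have hφ' : ∀ x, A.mkQ (φ x) = p x := LinearMap.congr_fun hφ
  refine ⟨P, φ, hP, hp.projective, hp.indecomposable, fun hle => ?_, fun M _ _ ψ hψ => ?_⟩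
  · apply hS.1
    rw [eq_bot_iff]
    intro s hs
    obtain ⟨x, hx⟩ := hp.surjective ⟨s, hs⟩
    have h1 : A.mkQ (φ x) = 0 := (Submodule.Quotient.mk_eq_zero A).2 (hle ⟨x, rfl⟩)
    rw [hφ', hx] at h1
    exact h1
  · rintro _ ⟨m, rfl⟩
    have h1 : p (ψ m) = 0 := LinearMap.congr_fun (hp.comp_eq_zero_of_isRadicalMap hψ) m
    have h2 : A.mkQ (φ (ψ m)) = 0 := by rw [hφ', h1]; rfl
    exact (Submodule.Quotient.mk_eq_zero A).1 h2

end Projective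

/-! ### Invariance under isomorphism -/

section Invariance

variable {R Λ : Type u} [CommRing R] [Ring Λ] [Algebra R Λ] {X Y : Type u} [AddCommGroup X]
  [Module Λ X] [AddCommGroup Y] [Module Λ Y] {α : X →ₗ[Λ] Y} {M N : Type u} [AddCommGroup M]
  [Module Λ M] [AddCommGroup N] [Module Λ N]

theorem IsSummandOf.of_equiv (e : M ≃ₗ[Λ] N) : IsSummandOf Λ M N :=
  ⟨e.toLinearMap, e.symm.toLinearMap, LinearMap.ext e.symm_apply_apply⟩

theorem Indecomposable.of_equiv (e : M ≃ₗ[Λ] N) (h : Indecomposable Λ M) : Indecomposable Λ N := by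
  have := h.1
  refine ⟨e.symm.surjective.nontrivial, fun U V hUV => ?_⟩
  have := h.2 (U.comap e.toLinearMap) (V.comap e.toLinearMap)
    ((Submodule.orderIsoMapComap e).symm.isCompl hUV)
  refine this.imp (fun h => ?_) (fun h => ?_)
  · exact (Submodule.orderIsoMapComap e).symm.injective (h.trans (map_bot _).symm)
  · exact (Submodule.orderIsoMapComap e).symm.injective (h.trans (map_bot _).symm)

theorem AlmostFactorsThrough.of_equiv (e : M ≃ₗ[Λ] N) (h : AlmostFactorsThrough α M) :
    AlmostFactorsThrough α N := by
  obtain ⟨hind, η, hη, hrad⟩ := h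
  refine ⟨hind.of_equiv e, η ∘ₗ e.symm.toLinearMap, fun hf => hη ?_, fun Z _ _ _ ψ hψ => ?_⟩
  · have := hf.comp e.toLinearMap
    rwa [LinearMap.comp_assoc, LinearEquiv.symm_comp, LinearMap.comp_id] at this
  · exact hrad Z (e.symm.toLinearMap ∘ₗ ψ) fun g => hψ (g ∘ₗ e.symm.toLinearMap)

theorem IsDeterminerSummand.of_equiv {K : Type u} [AddCommGroup K] [Module Λ K] (e : M ≃ₗ[Λ] N)
    (h : IsDeterminerSummand R α K M) : IsDeterminerSummand R α K N := by
  obtain ⟨hfin, h⟩ := h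
  refine ⟨Module.Finite.equiv e, h.imp ?_ ?_⟩
  · rintro ⟨L, hc, hL, P₁, P₀, f, p, hfp, ⟨e'⟩⟩
    exact ⟨L, hc, hL, P₁, P₀, f, p, hfp, ⟨e.symm.trans e'⟩⟩
  · rintro ⟨hp, ha⟩
    exact ⟨Module.Projective.of_equiv e, ha.of_equiv e⟩

end Invariance

/-! ### The minimal right determiner -/

section Determiner

variable {R Λ : Type u} [CommRing R] [Ring Λ] [Algebra R Λ] {X Y : Type u} [AddCommGroup X]
  [Module Λ X] [AddCommGroup Y] [Module Λ Y] {α : X →ₗ[Λ] Y} {K : Type u} [AddCommGroup K]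
  [Module Λ K]

theorem IsIntrinsicKernel.exists_embedding (hK : IsIntrinsicKernel α K) :
    ∃ X₀ X₁ : Submodule Λ X, IsCompl X₀ X₁ ∧ X₀ ≤ LinearMap.ker α ∧
      IsRightMinimal (α.domRestrict X₁) ∧ ∃ k : K →ₗ[Λ] X₁, Function.Injective k ∧
        LinearMap.range k = LinearMap.ker (α.domRestrict X₁) := by
  obtain ⟨X₀, X₁, hc, h₀, hmin, ⟨e⟩⟩ := hK
  refine ⟨X₀, X₁, hc, h₀, hmin, Submodule.subtype _ ∘ₗ e.toLinearMap,
    (Submodule.injective_subtype _).comp e.injective, ?_⟩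
  rw [LinearMap.range_comp, LinearEquiv.range, Submodule.map_top, Submodule.range_subtype]

theorem IsIntrinsicKernel.finite [IsNoetherian Λ X] (hK : IsIntrinsicKernel α K) :
    Module.Finite Λ K := by
  obtain ⟨X₀, X₁, -, -, -, k, hk, -⟩ := hK.exists_embedding
  exact Module.Finite.of_injective k hk

variable (R Λ X Y) in
/-- The isomorphism classes of the summands of the determiner form a set. -/
theorem exists_isDeterminerFamily (α : X →ₗ[Λ] Y) (K : Type u) [AddCommGroup K] [Module Λ K] :
    ∃ (ι : Type u) (N : ι → ModuleCat.{u} Λ), IsDeterminerFamily R α K N := by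
  -- Every finitely generated module is a quotient of some `Λ ^ n`, which keeps the index type in
  -- `Type u`.
  let T : Type u := {a : Σ n : ℕ, Submodule Λ (Fin n → Λ) //
    IsDeterminerSummand R α K ((Fin a.1 → Λ) ⧸ a.2)}
  let s : Setoid T :=
    { r := fun a b => Nonempty (((Fin a.1.1 → Λ) ⧸ a.1.2) ≃ₗ[Λ] ((Fin b.1.1 → Λ) ⧸ b.1.2))
      iseqv := ⟨fun _ => ⟨LinearEquiv.refl _ _⟩, fun ⟨e⟩ => ⟨e.symm⟩,
        fun ⟨e⟩ ⟨e'⟩ => ⟨e.trans e'⟩⟩ }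
  refine ⟨Quotient s, fun q => ModuleCat.of Λ ((Fin q.out.1.1 → Λ) ⧸ q.out.1.2),
    fun q => q.out.2, fun q q' h => ?_, fun M _ _ hM => ?_⟩
  · rw [← q.out_eq, ← q'.out_eq]
    exact Quotient.sound h
  · have := hM.1
    obtain ⟨n, f, hf⟩ := Module.Finite.exists_fin' Λ M
    let e := f.quotKerEquivOfSurjective hf
    let a : T := ⟨⟨n, LinearMap.ker f⟩, hM.of_equiv e.symm⟩
    obtain ⟨e'⟩ := Quotient.exact (Quotient.out_eq (Quotient.mk s a))
    exact ⟨Quotient.mk s a, ⟨e.symm.trans e'.symm⟩⟩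

variable [IsArtinianRing R] [Module.Finite R Λ] [Module.Finite Λ X]

/-- The transpose of a projective module is zero, so `Tr D(L) ≠ 0` needs an argument: it carries a
map that does not factor through `α`. -/
theorem IsDeterminerSummand.isLocalRing (hK : IsIntrinsicKernel α K) {N : Type u}
    [AddCommGroup N] [Module Λ N] (hN : IsDeterminerSummand R α K N) :
    IsLocalRing (Module.End Λ N) := by
  have : IsArtinianRing Λ := IsArtinianRing.of_finite R Λ
  have := hK.finite
  obtain ⟨hfin, ⟨L, ⟨L', hLL'⟩, hL, hLN⟩ | ⟨-, hN⟩⟩ := hN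
  · obtain ⟨X₀, X₁, hc, h₀, hmin, k, hk, hkα⟩ := hK.exists_embedding
    obtain ⟨η, hη, -⟩ := hmin.exists_not_factorsThrough hk hkα hLL' hL hLN
    have : Nontrivial N := by
      by_contra h
      rw [not_nontrivial_iff_subsingleton] at h
      refine hη ⟨0, LinearMap.ext fun x => ?_⟩
      rw [Subsingleton.elim x 0, map_zero, map_zero]
    exact hLN.isLocalRing hL
  · exact hN.1.isLocalRing

theorem IsDeterminerSummand.isSummandOf (hK : IsIntrinsicKernel α K) {N : Type u}
    [AddCommGroup N] [Module Λ N] (hN : IsDeterminerSummand R α K N) {C : Type u}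
    [AddCommGroup C] [Module Λ C] [Module.Finite Λ C] (hC : RightDetermined α C) :
    IsSummandOf Λ N C := by
  have : IsArtinianRing Λ := IsArtinianRing.of_finite R Λ
  have := hK.finite
  obtain ⟨hfin, ⟨L, ⟨L', hLL'⟩, hL, hLN⟩ | ⟨-, hN⟩⟩ := hN
  · obtain ⟨X₀, X₁, hc, h₀, hmin, k, hk, hkα⟩ := hK.exists_embedding
    rw [← rightDetermined_domRestrict_iff hc h₀] at hC
    obtain ⟨η, hη, hψ⟩ := hmin.exists_not_factorsThrough hk hkα hLL' hL hLN
    exact hC.isSummandOf hη fun ψ => hψ C ψ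
  · exact hN.isSummandOf hC

theorem IsIntrinsicKernel.factorsThrough (hK : IsIntrinsicKernel α K) {l : List (Module.End Λ K)}
    (hl : ∀ e ∈ l, IsIdempotentElem e ∧ Indecomposable Λ (LinearMap.range e)) (hs : l.sum = 1)
    {X' : Type u} [AddCommGroup X'] [Module Λ X'] {α' : X' →ₗ[Λ] Y}
    (hα' : LinearMap.range α' ≤ LinearMap.range α)
    (h : ∀ e ∈ l, ∃ N : ModuleCat.{u} Λ, IsTrD R Λ (LinearMap.range e) N ∧
      ∀ φ : N →ₗ[Λ] X', FactorsThrough α (α' ∘ₗ φ)) : FactorsThrough α α' := by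
  have : IsArtinianRing Λ := IsArtinianRing.of_finite R Λ
  have := hK.finite
  obtain ⟨X₀, X₁, hc, h₀, -, k, hk, hkα⟩ := hK.exists_embedding
  rw [← factorsThrough_domRestrict_iff hc h₀]
  refine factorsThrough_of_forall_isTrD hk hkα hl hs (hα'.trans ?_) (R := R) fun e he => ?_
  · exact ((factorsThrough_domRestrict_iff hc h₀ α).2 ⟨LinearMap.id, rfl⟩).range_le
  · simpa only [factorsThrough_domRestrict_iff hc h₀] using h e he

/-- A crude determiner, used only for finiteness: the factor `Λ` tests elements and so forces image
containment, and the other factors handle the kernel. -/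
theorem IsIntrinsicKernel.exists_rightDetermined (R : Type u) [CommRing R] [Algebra R Λ]
    [IsArtinianRing R] [Module.Finite R Λ] (hK : IsIntrinsicKernel α K) :
    ∃ C : ModuleCat.{u} Λ, Module.Finite Λ C ∧ RightDetermined α C := by
  classical
  have : IsArtinianRing Λ := IsArtinianRing.of_finite R Λ
  have := hK.finite
  obtain ⟨l, hl, hs⟩ := exists_indecomposable_idempotents (S := Λ) (M := K)
  choose N hNf hN using fun e : {e // e ∈ l} => exists_isTrD R (Λ := Λ) (LinearMap.range e.1)
  have : Finite {e // e ∈ l} := List.finite_toSet l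
  refine ⟨ModuleCat.of Λ (Λ × ∀ e, N e), inferInstanceAs (Module.Finite Λ (Λ × ∀ e, N e)),
    fun X' _ _ _ α' h => ?_⟩
  refine hK.factorsThrough (R := R) hl hs ?_ fun e he => ⟨N ⟨e, he⟩, hN ⟨e, he⟩, ?_⟩
  · rintro _ ⟨x, rfl⟩
    have h1 : IsSummandOf Λ Λ (Λ × ∀ e, N e) :=
      ⟨LinearMap.inl _ _ _, LinearMap.fst _ _ _, LinearMap.fst_comp_inl _ _ _⟩
    have h2 := (h1.factorsThrough h (LinearMap.toSpanSingleton Λ X' x)).range_le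
    exact h2 ⟨1, by simp⟩
  · have h1 : IsSummandOf Λ (N ⟨e, he⟩) (Λ × ∀ e, N e) :=
      ⟨LinearMap.inr _ _ _ ∘ₗ LinearMap.single Λ (fun e => N e) ⟨e, he⟩,
        LinearMap.proj (φ := fun e => N e) ⟨e, he⟩ ∘ₗ LinearMap.snd _ _ _,
        LinearMap.ext fun x => by simp⟩
    exact h1.factorsThrough h

variable {ι : Type u} {N : ι → ModuleCat.{u} Λ}

/-- Each member is a summand of one fixed determiner of finite length, hence isomorphic to one of
its finitely many indecomposable pieces. -/
theorem IsDeterminerFamily.finite (hK : IsIntrinsicKernel α K)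
    (hN : IsDeterminerFamily R α K N) : Finite ι := by
  have : IsArtinianRing Λ := IsArtinianRing.of_finite R Λ
  obtain ⟨C, hCf, hC⟩ := hK.exists_rightDetermined R
  obtain ⟨l, hl, hs⟩ := exists_indecomposable_idempotents (S := Λ) (M := C)
  have hex : ∀ i, ∃ e : {e // e ∈ l}, Nonempty (N i ≃ₗ[Λ] LinearMap.range e.1) := fun i => by
    have := (hN.mem i).isLocalRing hK
    obtain ⟨e, he, h⟩ := ((hN.mem i).isSummandOf hK hC).exists_equiv_range hl hs
    exact ⟨⟨e, he⟩, h⟩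
  choose F hF using hex
  have : Finite {e // e ∈ l} := List.finite_toSet l
  refine Finite.of_injective F fun i j hij => hN.eq_of_iso i j ?_
  obtain ⟨a⟩ := hF i
  obtain ⟨b⟩ := hF j
  rw [← hij] at b
  exact ⟨a.trans b.symm⟩

theorem IsDeterminerFamily.rightDetermined (hK : IsIntrinsicKernel α K)
    (hN : IsDeterminerFamily R α K N) : RightDetermined α (⨁ i, N i) := by
  classical
  have : IsArtinianRing Λ := IsArtinianRing.of_finite R Λ
  have := hK.finite
  obtain ⟨l, hl, hs⟩ := exists_indecomposable_idempotents (S := Λ) (M := K)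
  have hsum : ∀ (M : Type u) [AddCommGroup M] [Module Λ M], IsDeterminerSummand R α K M →
      IsSummandOf Λ M (⨁ i, N i) := by
    intro M _ _ hM
    obtain ⟨i, ⟨e⟩⟩ := hN.exists_iso M hM
    refine (IsSummandOf.of_equiv e).trans ⟨DirectSum.lof Λ ι (fun i => N i) i,
      DirectSum.component Λ ι (fun i => N i) i, LinearMap.ext fun x => ?_⟩
    exact DirectSum.component.lof_self Λ (M := fun i => N i) i x
  have hcase : ∀ (X' : Type u) [AddCommGroup X'] [Module Λ X'] (α' : X' →ₗ[Λ] Y),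
      LinearMap.range α' ≤ LinearMap.range α →
      (∀ φ : (⨁ i, N i) →ₗ[Λ] X', FactorsThrough α (α' ∘ₗ φ)) → FactorsThrough α α' := by
    intro X' _ _ α' hα' h
    refine hK.factorsThrough (R := R) hl hs hα' fun e he => ?_
    obtain ⟨M, hMf, hM⟩ := exists_isTrD R (Λ := Λ) (LinearMap.range e)
    refine ⟨M, hM,
      (hsum M ⟨hMf, Or.inl ⟨_, ⟨LinearMap.ker e, ?_⟩, (hl e he).2, hM⟩⟩).factorsThrough h⟩
    exact LinearMap.IsIdempotentElem.isCompl (hl e he).1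
  intro X' _ _ _ α' h
  by_cases hα' : LinearMap.range α' ≤ LinearMap.range α
  · exact hcase X' α' hα' h
  exfalso
  -- `α' φ` witnesses that `P` almost factors through `α`: after a radical map the image condition
  -- holds and `hcase` applies. So `P` is a summand of the sum, and the hypothesis on `α'` makes `α'
  -- φ` factor, a contradiction.
  obtain ⟨P, φ, hPf, hPp, hPi, hφ, hrad⟩ := exists_projective_of_not_range_le hα'
  refine hφ ((hsum P ⟨hPf, Or.inr ⟨hPp, hPi, α' ∘ₗ φ, fun h' => hφ h'.range_le,
    fun M _ _ _ ψ hψ => hcase M _ (hrad M ψ hψ) fun χ => ?_⟩⟩).factorsThrough h φ).range_le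
  exact h (φ ∘ₗ ψ ∘ₗ χ)

theorem IsDeterminerFamily.isMinimalRightDeterminer (hK : IsIntrinsicKernel α K)
    (hN : IsDeterminerFamily R α K N) : IsMinimalRightDeterminer α (⨁ i, N i) := by
  have := hN.finite hK
  have : ∀ i, Module.Finite Λ (N i) := fun i => (hN.mem i).1
  refine ⟨?_, hN.rightDetermined hK, fun C _ _ _ hC => ?_⟩
  · have := Fintype.ofFinite ι
    exact Module.Finite.equiv (DirectSum.linearEquivFunOnFintype Λ ι (fun i => N i)).symm
  · exact isSummandOf_directSum (fun i => N i) (fun i => (hN.mem i).isLocalRing hK) hN.eq_of_iso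
      fun i => (hN.mem i).isSummandOf hK hC

end Determiner

end

end RightDet

theorem theorem2 (R Λ : Type u) [CommRing R] [IsArtinianRing R] [Ring Λ] [Algebra R Λ]
    [Module.Finite R Λ] (X Y : Type u) [AddCommGroup X] [Module Λ X] [Module.Finite Λ X]
    [AddCommGroup Y] [Module Λ Y] [Module.Finite Λ Y] (α : X →ₗ[Λ] Y)
    (K' : Type u) [AddCommGroup K'] [Module Λ K'] (hK' : RightDet.IsIntrinsicKernel α K') :
    (∃ (ι : Type u) (N : ι → ModuleCat.{u} Λ), RightDet.IsDeterminerFamily R α K' N) ∧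
    ∀ (ι : Type u) (N : ι → ModuleCat.{u} Λ), RightDet.IsDeterminerFamily R α K' N →
      Finite ι ∧ RightDet.IsMinimalRightDeterminer α (⨁ i, N i) :=
  ⟨RightDet.exists_isDeterminerFamily R Λ X Y α K',
    fun _ _ hN => ⟨hN.finite hK', hN.isMinimalRightDeterminer hK'⟩⟩
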